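/- Throughout, a constant-length directive sequence $\boldsymbol\theta=(\theta^{(n)})_{n\ge 0}$ with length sequence $(q_n)_{n\ge0}$, $q_n\ge 1$, consists of finite alphabets $\mathcal A_n$ and morphisms $\theta^{(n)}\colon\mathcal A_{n+1}\to\mathcal A_n^{q_n}$; put $\theta^{[m,n)}=\theta^{(m)}\circ\cdots\circ\theta^{(n-1)}$ and $p_n=q_0\cdots q_{n-1}$. Let $X^{(n)}\subseteq\mathcal A_n^{\mathbb Z}$ be the set of two-sided sequences all of whose finite subwords are subwords of some $\theta^{[n,N)}(a)$ with $N>n$, $a\in\mathcal A_N$, let $X_{\boldsymbol\theta}=X^{(0)}$, and let $\sigma$ be the left shift. The sequence $\boldsymbol\theta$ is *torsion-free* if $q_n>1$ infinitely often, each $(X^{(n)},\sigma)$ is minimal, $X^{(0)}$ contains no shift-periodic point, and every prime that divides some $q_k$ divides $q_n$ for infinitely many $n$. Let $\mathbb Z_{(q_n)}=\varprojlim\mathbb Z/p_n\mathbb Z$ be the odometer. The *height* of $\boldsymbol\theta$ is the integer $h\ge1$, coprime to every $q_n$, for which $(\mathbb Z_{(q_n)}\times\mathbb Z/h\mathbb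 Z,(+1,+1))$ is the maximal equicontinuous factor (MEF) of $(X_{\boldsymbol\theta},\sigma)$. *Naïve column number.* The injectivisation $\widehat{\boldsymbol\theta}$ is obtained from $\boldsymbol\theta$ by identifying letters level by level: nothing is identified in $\mathcal A_0$, and two letters of $\mathcal A_{n+1}$ are identified if their images under $\theta^{(n)}$ coincide after the identifications in $\mathcal A_n$. If all $\theta^{(n)}$ are injective on letters, then $\widehat{\boldsymbol\theta}=\boldsymbol\theta$. For $0\le j<p_n/p_m$, the $j$-th column of $\theta^{[m,n)}$ is the map $(\theta^{[m,n)})_j\colon\mathcal A_n\to\mathcal A_m$ sending $a$ to the $j$-th letter of $\theta^{[m,n)}(a)$, and $c(\boldsymbol\theta,m)=\min\{|(\theta^{[m,n)})_j(\mathcal A_n)|: n>m,\ 0\le j<p_n/p_m\}$. The naïve column number is $\bar c(\boldsymbol\theta)=\max_{m\ge0}c(\widehat{\boldsymbol\theta},m)=\lim_{m\to\infty}c(\widehat{\boldsymbol\theta},m)$. *Pure base and column number.* Let $u^{(n)}\in X^{(n)}$, $n\ge0$, be such that $\theta^{(n)}(u^{(n+1)})=u^{(n)}$ for all $n$, and let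 $h$ be the height. Let $\mathcal B_n$ be the set of the words $u^{(n)}_{kh}\cdots u^{(n)}_{(k+1)h-1}$, $k\ge0$. The pure base $\bar{\boldsymbol\theta}$ consists of the morphisms $\bar\theta^{(n)}\colon\mathcal B_{n+1}\to\mathcal B_n^{q_n}$ for which $\bar\theta^{(n)}(w)$ is the word $\theta^{(n)}(w)$, of length $q_nh$, cut into $q_n$ consecutive words of length $h$. The column number of $\boldsymbol\theta$ is $c(\boldsymbol\theta)=\bar c(\bar{\boldsymbol\theta})$. **Corollary.** Let $\boldsymbol\theta$ be a torsion-free directive sequence on alphabets of bounded size. Then $\boldsymbol\theta$ has a unique height $h$, sequences $(u^{(n)})_{n\ge0}$ as above exist, and for each choice of $(u^{(n)})_{n\ge0}$ in the definition of the pure base and each maximal equicontinuous factor map $\pi_{\rm MEF}\colon(X_{\boldsymbol\theta},\sigma)\to(\mathbb Z_{(q_n)}\times\mathbb Z/h\mathbb Z,(+1,+1))$ the following holds: some fibre $\pi_{\rm MEF}^{-1}(z)$ has exactly $c(\boldsymbol\theta)$ elements, and no fibre has exactly $k$ elements for any $k<c(\boldsymbol\theta)$. -/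

import Mathlib

universe u v

/-! ### Topological dynamics -/

section Dynamics

/-- `π` is a factor map from the system `(X, T)` onto the system `(Z, S)`. -/
structure IsFactorMap {X : Type u} [TopologicalSpace X] (T : X → X)
    {Z : Type v} [TopologicalSpace Z] (S : Z → Z) (π : X → Z) : Prop where
  continuous : Continuous π
  surjective : Function.Surjective π
  semiconj : Function.Semiconj π T S

/-- A compact Hausdorff system `(Z, S)` is equicontinuous if the family of all iterates `S ^ n`,
`n ∈ ℤ`, is equicontinuous with respect to the uniformity of `Z` (a compact Hausdorff space
carries exactly one uniformity that induces its topology). -/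
structure IsEquicontinuousSystem {Z : Type v} [τ : TopologicalSpace Z] (S : Z ≃ₜ Z) : Prop where
  compact : CompactSpace Z
  hausdorff : T2Space Z
  equicontinuous : ∃ 𝒰 : UniformSpace Z, 𝒰.toTopologicalSpace = τ ∧
    @Equicontinuous ℤ Z Z τ 𝒰 (fun n z => (S ^ n) z)

/-- `π : (X, T) → (Z, S)` is a maximal equicontinuous factor map: `(Z, S)` is an equicontinuous
factor of `(X, T)` through `π`, and any other equicontinuous factor map `ρ : (X, T) → (Y, R)`
factors through `π`. (Up to homeomorphism a compact Hausdorff factor of a compact space `X` is a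
quotient space of `X`, so the universe of `X` suffices for `Y`.) -/
structure IsMEFMap {X : Type u} [TopologicalSpace X] (T : X → X)
    {Z : Type v} [TopologicalSpace Z] (S : Z ≃ₜ Z) (π : X → Z) : Prop where
  factor : IsFactorMap T S π
  equicontinuous : IsEquicontinuousSystem S
  maximal : ∀ (Y : Type u) [TopologicalSpace Y] (R : Y ≃ₜ Y) (ρ : X → Y),
    IsEquicontinuousSystem R → IsFactorMap T R ρ →
      ∃ φ : Z → Y, IsFactorMap S R φ ∧ ρ = φ ∘ π

end Dynamics

/-! ### Odometers -/

section Odometer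

/-- The odometer group `ℤ_(q_n) = lim ℤ / p_n ℤ`, where `p_n = q_0 ⋯ q_{n-1}`, with the topology
induced by the product of the discrete topologies. -/
def odometer (q : ℕ → ℕ) : AddSubgroup (∀ n, ZMod (∏ i ∈ Finset.range n, q i)) where
  carrier := {z | ∀ n, ZMod.castHom (Dvd.intro (q n) (Finset.prod_range_succ q n).symm)
    (ZMod (∏ i ∈ Finset.range n, q i)) (z (n + 1)) = z n}
  zero_mem' := fun n => map_zero _
  add_mem' := fun {a b} ha hb n => by
    simp only [Set.mem_ofPred_eq] at ha hb
    rw [Pi.add_apply, Pi.add_apply, map_add, ha n, hb n]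
  neg_mem' := fun {a} ha n => by
    simp only [Set.mem_ofPred_eq] at ha
    rw [Pi.neg_apply, Pi.neg_apply, map_neg, ha n]

/-- The topological generator `1` of the odometer. -/
def odometerOne (q : ℕ → ℕ) : odometer q :=
  ⟨fun _ => 1, fun _ => map_one _⟩

/-- The rotation `(+1, +1)` on `ℤ_(q_n) × ℤ / h ℤ`. -/
def odometerRotation (q : ℕ → ℕ) (h : ℕ) : (odometer q × ZMod h) ≃ₜ (odometer q × ZMod h) :=
  Homeomorph.addRight (odometerOne q, (1 : ZMod h))

end Odometer

/-! ### Two-sided sequences -/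

/-- Two-sided infinite sequences over the alphabet `α`. -/
def BiSeq (α : Type u) : Type u := ℤ → α

namespace BiSeq

/-- The product topology over the discrete topology on the alphabet. -/
instance (α : Type u) : TopologicalSpace (BiSeq α) :=
  @Pi.topologicalSpace ℤ (fun _ => α) (fun _ => ⊥)

/-- The left shift. -/
def shift {α : Type u} (x : BiSeq α) : BiSeq α := fun i => x (i + 1)

/-- A set of sequences is a minimal shift if it is non-empty, closed and shift invariant and
contains no closed shift invariant subset except the empty set and itself. -/
def IsMinimalShift {α : Type u} (X : Set (BiSeq α)) : Prop :=
  X.Nonempty ∧ IsClosed X ∧ shift ⁻¹' X = X ∧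
    ∀ Y ⊆ X, IsClosed Y → shift ⁻¹' Y = Y → Y = ∅ ∨ Y = X

/-- No element of `X` is periodic under the shift. -/
def IsAperiodic {α : Type u} (X : Set (BiSeq α)) : Prop :=
  ∀ x ∈ X, ∀ k : ℕ, 0 < k → shift^[k] x ≠ x

end BiSeq

/-! ### Constant-length directive sequences -/

/-- A constant-length directive sequence: finite alphabets `A n` and morphisms
`θ n : A (n + 1) → (A n) ^ (q n)`, with letters mapped to non-empty words. The letter at place `j`
of the word `θ n a` is `θ n a j`; that is, `fun a => θ n a j` is the `j`-th column. -/
structure DirectiveSeq where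
  /-- the alphabets -/
  A : ℕ → Type u
  finite : ∀ n, Finite (A n)
  /-- the length sequence -/
  q : ℕ → ℕ
  q_pos : ∀ n, 0 < q n
  /-- the morphisms -/
  θ : ∀ n, A (n + 1) → Fin (q n) → A n

namespace DirectiveSeq

/-- The length `q_m ⋯ q_{m+k-1}` of the morphism `θ^[m, m+k)`. -/
def len (D : DirectiveSeq.{u}) (m k : ℕ) : ℕ := ∏ i ∈ Finset.range k, D.q (m + i)

theorem len_pos (D : DirectiveSeq.{u}) (m k : ℕ) : 0 < D.len m k :=
  Finset.prod_pos fun _ _ => D.q_pos _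

theorem len_succ (D : DirectiveSeq.{u}) (m k : ℕ) :
    D.len m (k + 1) = D.len m k * D.q (m + k) :=
  Finset.prod_range_succ _ _

/-- The morphism `θ^[m, m+k) = θ^(m) ∘ θ^(m+1) ∘ ⋯ ∘ θ^(m+k-1)`, as a map from letters to words:
`D.comp m k a j` is the letter at place `j` of the word `θ^[m, m+k)(a)`. -/
def comp (D : DirectiveSeq.{u}) (m : ℕ) : ∀ k, D.A (m + k) → Fin (D.len m k) → D.A m
  | 0, a, _ => a
  | k + 1, a, j =>
    comp D m k
      (D.θ (m + k) a ⟨j / D.len m k, Nat.div_lt_of_lt_mul (D.len_succ m k ▸ j.isLt)⟩)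
      ⟨j % D.len m k, Nat.mod_lt _ (D.len_pos m k)⟩

/-- The word `w` is a subword of `θ^[n, N)(a)` for some `N > n` and some letter `a` of `A N`. -/
def InLanguage (D : DirectiveSeq.{u}) (n : ℕ) {L : ℕ} (w : Fin L → D.A n) : Prop :=
  ∃ k, 0 < k ∧ ∃ (a : D.A (n + k)) (j : ℕ) (hj : j + L ≤ D.len n k),
    ∀ t : Fin L, w t = D.comp n k a ⟨j + t, by have := t.isLt; omega⟩

/-- The level-`n` shift `X^(n)`: all two-sided sequences all of whose subwords are in the
language of level `n`. The `S`-adic shift generated by the directive sequence is `D.X 0`. -/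
def X (D : DirectiveSeq.{u}) (n : ℕ) : Set (BiSeq (D.A n)) :=
  {x | ∀ (i : ℤ) (L : ℕ), D.InLanguage n (fun t : Fin L => x (i + (t : ℕ)))}

theorem shift_mem_X (D : DirectiveSeq.{u}) (n : ℕ) {x : BiSeq (D.A n)} (hx : x ∈ D.X n) :
    x.shift ∈ D.X n := by
  intro i L
  have h := hx (i + 1) L
  have e : (fun t : Fin L => x (i + 1 + (t : ℕ))) = fun t : Fin L => x.shift (i + (t : ℕ)) := by
    funext t
    show x _ = x _
    congr 1
    ring
  rwa [e] at h

/-- The left shift `σ` on the `S`-adic shift `X_θ = X^(0)`. -/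
def shift (D : DirectiveSeq.{u}) : D.X 0 → D.X 0 :=
  fun x => ⟨x.1.shift, D.shift_mem_X 0 x.2⟩

/-- The alphabets have bounded size. -/
def BoundedAlphabets (D : DirectiveSeq.{u}) : Prop := ∃ K : ℕ, ∀ n, Nat.card (D.A n) ≤ K

/-- Torsion-free directive sequences. -/
structure TorsionFree (D : DirectiveSeq.{u}) : Prop where
  infinite_length : {n | 1 < D.q n}.Infinite
  minimal : ∀ n, BiSeq.IsMinimalShift (D.X n)
  aperiodic : BiSeq.IsAperiodic (D.X 0)
  prime_dvd : ∀ p : ℕ, p.Prime → ∀ k, p ∣ D.q k → {n | p ∣ D.q n}.Infinite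

/-- The height of a directive sequence: the positive integer `h`, coprime to every length `q_n`,
for which `(ℤ_(q_n) × ℤ / h ℤ, (+1, +1))` is the maximal equicontinuous factor of `(X_θ, σ)`. -/
def IsHeight (D : DirectiveSeq.{u}) (h : ℕ) : Prop :=
  0 < h ∧ (∀ n, Nat.Coprime h (D.q n)) ∧
    ∃ π : D.X 0 → odometer D.q × ZMod h, IsMEFMap D.shift (odometerRotation D.q h) π

/-- The action of the morphism `θ^(n)` on two-sided sequences by concatenation; the image of the
letter at the origin starts at the origin. -/
def apply (D : DirectiveSeq.{u}) (n : ℕ) (x : BiSeq (D.A (n + 1))) : BiSeq (D.A n) :=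
  fun i => D.θ n (x (i / (D.q n : ℤ))) ⟨(i % (D.q n : ℤ)).toNat, by
    have h : (0 : ℤ) < D.q n := by exact_mod_cast D.q_pos n
    have h1 := Int.emod_nonneg i h.ne'
    have h2 := Int.emod_lt_of_pos i h
    omega⟩

/-- A limit word `u^(0)` together with its desubstitutions `u^(n)`: points `u^(n)` of `X^(n)` with
`θ^(n)(u^(n+1)) = u^(n)`. -/
structure LimitWord (D : DirectiveSeq.{u}) where
  u : ∀ n, BiSeq (D.A n)
  mem : ∀ n, u n ∈ D.X n
  apply_eq : ∀ n, D.apply n (u (n + 1)) = u n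

/-- The words of length `h` that appear in `x` at the places `k h`, `k ≥ 0`. -/
def blocks {α : Type u} (h : ℕ) (x : BiSeq α) : Set (Fin h → α) :=
  {w | ∃ k : ℕ, ∀ i : Fin h, w i = x ((k * h + i : ℕ) : ℤ)}

/-- The letter at place `j` of the word `θ^(n)(w)`, where `w` is a word of length `h`. -/
def wordImage (D : DirectiveSeq.{u}) (n : ℕ) {h : ℕ} (w : Fin h → D.A (n + 1))
    (j : Fin (D.q n * h)) : D.A n :=
  D.θ n (w ⟨j / D.q n, Nat.div_lt_of_lt_mul j.isLt⟩) ⟨j % D.q n, Nat.mod_lt _ (D.q_pos n)⟩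

theorem block_index_lt {q h : ℕ} (j : Fin q) (i : Fin h) : (j : ℕ) * h + i < q * h :=
  calc (j : ℕ) * h + i < j * h + h := Nat.add_lt_add_left i.isLt _
    _ = (j + 1) * h := by ring
    _ ≤ q * h := Nat.mul_le_mul_right _ j.isLt

theorem wordImage_mem_blocks (D : DirectiveSeq.{u}) (U : D.LimitWord) (n : ℕ) {h : ℕ}
    {w : Fin h → D.A (n + 1)} (hw : w ∈ blocks h (U.u (n + 1))) (j : Fin (D.q n)) :
    (fun i : Fin h => D.wordImage n w ⟨j * h + i, block_index_lt j i⟩) ∈ blocks h (U.u n) := by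
  obtain ⟨k, hk⟩ := hw
  refine ⟨k * D.q n + j, fun i => ?_⟩
  have hq := D.q_pos n
  have hidx : (k * D.q n + j) * h + i = (j * h + i) + D.q n * (k * h) := by ring
  rw [← U.apply_eq n]
  simp only [wordImage, apply]
  rw [hk]
  have e1 : (((k * D.q n + j) * h + i : ℕ) : ℤ) / (D.q n : ℤ)
      = ((k * h + (j * h + i) / D.q n : ℕ) : ℤ) := by
    rw [← Int.natCast_ediv, hidx, Nat.add_mul_div_left _ _ hq, Nat.add_comm]
  have e2 : ((((k * D.q n + j) * h + i : ℕ) : ℤ) % (D.q n : ℤ)).toNat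
      = (j * h + i) % D.q n := by
    rw [← Int.natCast_emod, hidx, Int.toNat_natCast, Nat.add_mul_mod_self_left]
  congr 2
  · rw [e1]
  · exact e2.symm

/-- The pure base of a directive sequence with respect to a limit word `u` (and a positive integer
`h`, which is meant to be the height). The alphabet of level `n` is the set of the words of length
`h` at the places `k h`, `k ≥ 0`, of `u^(n)`; the image of such a word `w` is the word
`θ^(n)(w)` of length `q_n h`, read as a word of length `q_n` over the alphabet of the blocks of
length `h`. -/
def pureBase (D : DirectiveSeq.{u}) (U : D.LimitWord) (h : ℕ) : DirectiveSeq.{u} where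
  A n := blocks h (U.u n)
  finite n := by
    have := D.finite n
    infer_instance
  q := D.q
  q_pos := D.q_pos
  θ n w j := ⟨fun i => D.wordImage n w.1 ⟨j * h + i, block_index_lt j i⟩,
    D.wordImage_mem_blocks U n w.2 j⟩

/-- The identifications of letters that make all morphisms injective. At level `0` nothing is
identified; two letters of `A (n + 1)` are identified if their images under `θ^(n)` become equal
after the identifications of level `n`. -/
def identification (D : DirectiveSeq.{u}) : ∀ n, Setoid (D.A n)
  | 0 => ⊥
  | n + 1 =>
    { r := fun a b => ∀ j, (identification D n).r (D.θ n a j) (D.θ n b j)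
      iseqv :=
        ⟨fun _ _ => (identification D n).iseqv.refl _,
          fun h j => (identification D n).iseqv.symm (h j),
          fun h₁ h₂ j => (identification D n).iseqv.trans (h₁ j) (h₂ j)⟩ }

/-- The injectivisation of a directive sequence: the induced morphisms between the alphabets of
identified letters. They are injective on letters, and they generate the same shift. If all
morphisms are injective on letters already, then no letters are identified. -/
def injectivisation (D : DirectiveSeq.{u}) : DirectiveSeq.{u} where
  A n := Quotient (D.identification n)
  finite n := by
    have := D.finite n
    exact Quotient.finite _
  q := D.q
  q_pos := D.q_pos
  θ n := Quotient.lift (fun a j => Quotient.mk (D.identification n) (D.θ n a j))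
    (fun _ _ hab => funext fun j => Quotient.sound (hab j))

/-- `c(θ, m)`: the least cardinality of a column of `θ^[m, n)`, over all `n > m`. -/
noncomputable def columnMin (D : DirectiveSeq.{u}) (m : ℕ) : ℕ :=
  sInf {c | ∃ k, 0 < k ∧ ∃ j : Fin (D.len m k), c = (Set.range fun a => D.comp m k a j).ncard}

/-- The naïve column number: the maximum, which is also the limit, of the increasing and (for
bounded alphabets) bounded sequence of the numbers `c(θ', m)`, where `θ'` is the
injectivisation. -/
noncomputable def naiveColumnNumber (D : DirectiveSeq.{u}) : ℕ :=
  ⨆ m, D.injectivisation.columnMin m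

/-- The column number of a directive sequence of height `h`: the naïve column number of its pure
base (with respect to the limit word `U`). -/
noncomputable def columnNumber (D : DirectiveSeq.{u}) (U : D.LimitWord) (h : ℕ) : ℕ :=
  (D.pureBase U h).naiveColumnNumber

end DirectiveSeq

/-! Let `T` be the shift on `X^(0)`, `K` a bound for the alphabets, `p_n = q_0 ⋯ q_{n-1}`.

Equicontinuous side. The image `Y` of `X^(N)` under `θ^[0,N)` is minimal for `T ^ p_N`, and its
return times form a group `dℤ` with `d ∣ p_N`, so `ℤ/dℤ` is a factor
(`IsMinimalOn.exists_cyclicFactor`). In a point of `Y` one of at most `K` words of length `p_N`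
starts at each multiple of `d`; if `p_N` were large compared with `d`, their overlaps would force
the period `K! d` (`TorsionFree.totalLen_lt`). So `p_N / d` is bounded, and as every prime that
occurs has unbounded exponent in `p_N`, each `p_n` is the order of a cyclic factor. Conversely, in
an equicontinuous factor all multiples of `K! p_n`, for suitable `n`, act almost as the identity,
because places with equal letters differ by almost periods (`factorial_mul_mem_iteratedSum`,
`TorsionFree.exists_close_iterates`). Hence cyclic factors of order coprime to the lengths have
order dividing `K!`; with `h` the largest such order, the odometer times `ℤ/hℤ` separates all points
that some equicontinuous factor separates (`TorsionFree.isMEFMap`).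

Fibres. After injectivisation a letter of the pure base at level `m` is a word of length `h p_m` of
`u^(0)`, so a column is the set of such words along an arithmetic progression
(`columnMin_injectivisation_pureBase`). The orbit of `u^(0)` visits a level-`n` cylinder of the
factor exactly along a residue class modulo `h p_n`. By compactness, a deep enough cylinder around
`z` shows only words already seen in the fibre of `z`, so every fibre has at least as many points as
a smallest column (`TorsionFree.columnMin_le_encard`). Nesting residue classes so that a smallest
column surrounds the origin at infinitely many scales yields a fibre that attains the bound
(`TorsionFree.exists_encard_le`). -/

section MinimalSystems

/-! ### Minimal homeomorphisms and their cyclic factors -/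

variable {X : Type u} [TopologicalSpace X]

/-- A homeomorphism is minimal on `Y` if `Y` is non-empty, closed and forward invariant, and has no
proper subset with these properties. -/
structure IsMinimalOn (g : X ≃ₜ X) (Y : Set X) : Prop where
  nonempty : Y.Nonempty
  isClosed : IsClosed Y
  mapsTo : ∀ x ∈ Y, g x ∈ Y
  eq_of_subset : ∀ S ⊆ Y, IsClosed S → S.Nonempty → (∀ x ∈ S, g x ∈ S) → S = Y

/-- `ℤ / k ℤ` with the rotation by `1` is a factor, possibly under a non-surjective map. -/
def HasCyclicFactor (T : X ≃ₜ X) (k : ℕ) : Prop :=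
  ∃ f : X → ZMod k, Continuous f ∧ ∀ x, f (T x) = f x + 1

/-- By compactness a closed forward invariant set contains a non-empty two-sided invariant one, the
intersection of its forward images. -/
theorem IsMinimalOn.of_invariant [CompactSpace X] [Nonempty X] (T : X ≃ₜ X)
    (h : ∀ S : Set X, IsClosed S → S.Nonempty → T ⁻¹' S = S → S = Set.univ) :
    IsMinimalOn T Set.univ := by
  refine ⟨Set.univ_nonempty, isClosed_univ, fun _ _ => trivial, fun S _ hS hne hT => ?_⟩
  -- `V n` is the image of `S` under `T ^ n`.
  let V : ℕ → Set X := fun n => {x | (T⁻¹ ^ n) x ∈ S}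
  have hV : ∀ n, V (n + 1) ⊆ V n := fun n x hx => by
    have := hT _ hx
    simp only [V, Set.mem_ofPred_eq]
    convert this using 1
    rw [pow_succ', Homeomorph.mul_apply]
    exact (T.apply_symm_apply _).symm
  have hVc : ∀ n, IsClosed (V n) := fun n => hS.preimage (T⁻¹ ^ n).continuous
  have hanti : Antitone V := antitone_nat_of_succ_le hV
  have hn : (⋂ n, V n).Nonempty := by
    apply IsCompact.nonempty_iInter_of_directed_nonempty_isCompact_isClosed V
    · exact directed_of_isDirected_le hanti
    · intro n
      obtain ⟨x, hx⟩ := hne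
      refine ⟨(T⁻¹ ^ n)⁻¹ x, ?_⟩
      simp only [V, Set.mem_ofPred_eq]
      rw [← Homeomorph.mul_apply]
      simpa using hx
    · exact fun n => (hVc n).isCompact
    · exact hVc
  have hW := h (⋂ n, V n) (isClosed_iInter hVc) hn (by
    have key : ∀ n x, T x ∈ V (n + 1) ↔ x ∈ V n := fun n x => by
      simp only [V, Set.mem_ofPred_eq, pow_succ, Homeomorph.mul_apply]
      rw [show T⁻¹ (T x) = x from T.symm_apply_apply x]
    ext x
    simp only [Set.mem_preimage, Set.mem_iInter]
    constructor
    · exact fun hx n => (key n x).1 (hx (n + 1))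
    · exact fun hx n => hV n ((key n x).2 (hx n)))
  refine Set.eq_univ_of_univ_subset ?_
  rw [← hW]
  exact Set.iInter_subset V 0

theorem IsMinimalOn.apply_eq_of_invariant {T : X ≃ₜ X} (hT : IsMinimalOn T Set.univ) {Z : Type v}
    [TopologicalSpace Z] [T1Space Z] {g : X → Z} (hg : Continuous g) (h : ∀ x, g (T x) = g x)
    (x y : X) : g x = g y := by
  have := hT.eq_of_subset (g ⁻¹' {g y}) (Set.subset_univ _) (isClosed_singleton.preimage hg)
    ⟨y, rfl⟩ (fun x hx => by
      simp only [Set.mem_preimage, Set.mem_singleton_iff] at hx ⊢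
      rw [h, hx])
  exact this.ge (Set.mem_univ x)

theorem IsMinimalOn.exists_pow_mem {T : X ≃ₜ X} (hT : IsMinimalOn T Set.univ) {U : Set X}
    (hU : IsOpen U) (hne : U.Nonempty) (x : X) : ∃ n : ℕ, (T ^ n) x ∈ U := by
  by_contra! hcon
  let S : Set X := {y | ∀ n : ℕ, (T ^ n) y ∉ U}
  have hS : S = Set.univ := by
    refine hT.eq_of_subset S (Set.subset_univ _) ?_ ⟨x, hcon⟩ ?_
    · simp only [S, Set.ofPred_forall]
      exact isClosed_iInter fun n => (hU.preimage (T ^ n).continuous).isClosed_compl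
    · intro y hy n
      have := hy (n + 1)
      rwa [pow_succ, Homeomorph.mul_apply] at this
  obtain ⟨y, hy⟩ := hne
  exact hS.ge (Set.mem_univ y) 0 hy

theorem continuous_of_isClosed_preimage_singleton {Z : Type v} [TopologicalSpace Z]
    [DiscreteTopology Z] [Finite Z] {f : X → Z} (h : ∀ c, IsClosed (f ⁻¹' {c})) :
    Continuous f := by
  rw [continuous_iff_isClosed]
  intro s _
  rw [← Set.biUnion_preimage_singleton]
  exact s.toFinite.isClosed_biUnion fun c _ => h c

namespace HasCyclicFactor

variable {T : X ≃ₜ X}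

theorem of_dvd {k l : ℕ} (h : HasCyclicFactor T k) (hl : l ∣ k) : HasCyclicFactor T l := by
  obtain ⟨f, hf, hT⟩ := h
  refine ⟨fun x => ZMod.castHom hl (ZMod l) (f x), continuous_of_discreteTopology.comp hf, ?_⟩
  intro x
  simp only [hT, map_add, map_one]

theorem one : HasCyclicFactor T 1 := ⟨fun _ => 0, continuous_const, fun _ => Subsingleton.elim _ _⟩

theorem mul_of_coprime {k l : ℕ} (hk : HasCyclicFactor T k) (hl : HasCyclicFactor T l)
    (h : k.Coprime l) : HasCyclicFactor T (k * l) := by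
  obtain ⟨f, hf, hfT⟩ := hk
  obtain ⟨g, hg, hgT⟩ := hl
  refine ⟨fun x => (ZMod.chineseRemainder h).symm (f x, g x),
    continuous_of_discreteTopology.comp (hf.prodMk hg), fun x => ?_⟩
  simp only
  rw [hfT, hgT, ← map_one (ZMod.chineseRemainder h).symm, ← map_add]
  rfl

/-- The least common multiple is a product of two coprime numbers, one dividing `k` and one dividing
`l`. -/
theorem lcm {k l : ℕ} (hk0 : k ≠ 0) (hl0 : l ≠ 0) (hk : HasCyclicFactor T k)
    (hl : HasCyclicFactor T l) : HasCyclicFactor T (k.lcm l) := by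
  rw [← Nat.factorizationLCMLeft_mul_factorizationLCMRight hk0 hl0]
  exact (hk.of_dvd (Nat.factorizationLCMLeft_dvd_left _ _)).mul_of_coprime
    (hl.of_dvd (Nat.factorizationLCMRight_dvd_right _ _))
    (Nat.coprime_factorizationLCMLeft_factorizationLCMRight _ _)

theorem of_prime_pow {n : ℕ} (hn : n ≠ 0)
    (h : ∀ p, p.Prime → p ∣ n → ∀ e, HasCyclicFactor T (p ^ e)) : HasCyclicFactor T n := by
  induction n using Nat.recOnPosPrimePosCoprime with
  | prime_pow p n hp hpos => exact h p hp (dvd_pow_self p hpos.ne') n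
  | zero => exact absurd rfl hn
  | one => exact one
  | coprime a b ha hb hab iha ihb =>
    exact (iha (by omega) fun p hp hd => h p hp (hd.mul_right b)).mul_of_coprime
      (ihb (by omega) fun p hp hd => h p hp (hd.mul_left a)) hab

end HasCyclicFactor

theorem Homeomorph.zpow_add_apply' (T : X ≃ₜ X) (a b : ℤ) (x : X) :
    (T ^ (a + b)) x = (T ^ a) ((T ^ b) x) := by
  rw [zpow_add, Homeomorph.mul_apply]

/-- The components of `T ^ P`, where `T` is minimal, are permuted cyclically by `T`. -/
theorem IsMinimalOn.exists_cyclicFactor {T : X ≃ₜ X} (hT : IsMinimalOn T Set.univ) {P : ℕ}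
    (hP : 0 < P) {Y : Set X} (hY : IsMinimalOn (T ^ P) Y) :
    ∃ d : ℕ, 0 < d ∧ d ∣ P ∧ (∀ x ∈ Y, ∀ k : ℤ, (T ^ (d * k)) x ∈ Y) ∧
      ∃ f : X → ZMod d, Continuous f ∧ (∀ x, f (T x) = f x + 1) ∧ ∀ x, f x = 0 ↔ x ∈ Y := by
  have hPz : ∀ x, (T ^ (P : ℤ)) x = (T ^ P) x := fun x => by rw [zpow_natCast]
  have hcomm : ∀ (k : ℤ) x, (T ^ k) ((T ^ P) x) = (T ^ P) ((T ^ k) x) := fun k x => by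
    rw [← hPz, ← hPz, ← Homeomorph.zpow_add_apply', ← Homeomorph.zpow_add_apply', add_comm]
  have hinv : ∀ (k : ℤ) x, (T ^ (-k)) ((T ^ k) x) = x := fun k x => by
    rw [← Homeomorph.zpow_add_apply']; simp
  -- `Y` meets its image only if the two agree
  have key : ∀ (k : ℤ), (∃ x ∈ Y, (T ^ k) x ∈ Y) → ∀ x ∈ Y, (T ^ k) x ∈ Y := by
    rintro k ⟨x, hx, hkx⟩
    have := hY.eq_of_subset (Y ∩ (T ^ k) ⁻¹' Y) Set.inter_subset_left
      (hY.isClosed.inter (hY.isClosed.preimage (T ^ k).continuous)) ⟨x, hx, hkx⟩ (by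
        rintro y ⟨hy, hky⟩
        refine ⟨hY.mapsTo y hy, ?_⟩
        rw [Set.mem_preimage, hcomm]
        exact hY.mapsTo _ hky)
    exact fun y hy => (this.ge hy).2
  -- The return times of `Y`; `key` makes them closed under negation.
  let H : AddSubgroup ℤ :=
    { carrier := {k | ∀ x ∈ Y, (T ^ k) x ∈ Y}
      zero_mem' := fun x hx => by simpa using hx
      add_mem' := fun {a b} ha hb x hx => by
        rw [Homeomorph.zpow_add_apply']
        exact ha _ (hb _ hx)
      neg_mem' := fun {a} ha => by
        obtain ⟨x, hx⟩ := hY.nonempty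
        exact key (-a) ⟨(T ^ a) x, ha x hx, by rwa [hinv]⟩ }
  obtain ⟨a, ha⟩ := Int.subgroup_cyclic H
  rw [← AddSubgroup.zmultiples_eq_closure] at ha
  have hmem : ∀ k : ℤ, (∀ x ∈ Y, (T ^ k) x ∈ Y) ↔ (a.natAbs : ℤ) ∣ k := fun k => by
    rw [Int.natAbs_dvd, ← Int.mem_zmultiples_iff, ← ha]
    rfl
  set d := a.natAbs with hd
  have hdP : d ∣ P := by
    have := (hmem P).1 (fun x hx => by rw [hPz]; exact hY.mapsTo x hx)
    exact_mod_cast this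
  have hd0 : 0 < d := Nat.pos_of_dvd_of_pos hdP hP
  have hex : ∀ x, ∃ j : ℤ, (T ^ j) x ∈ Y := by
    -- Forward invariant because `T ^ P` preserves `Y`: the index `0` wraps around to `P - 1`.
    let S : Set X := ⋃ j ∈ Finset.range P, (T ^ (j : ℤ)) ⁻¹' Y
    have hS : S = Set.univ := by
      refine hT.eq_of_subset S (Set.subset_univ _) ?_ ?_ ?_
      · exact isClosed_biUnion_finset fun j _ => hY.isClosed.preimage (T ^ (j : ℤ)).continuous
      · obtain ⟨x, hx⟩ := hY.nonempty
        refine ⟨x, ?_⟩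
        simp only [S, Set.mem_iUnion]
        exact ⟨0, by simpa using hP, by simpa using hx⟩
      · intro x hx
        simp only [S, Set.mem_iUnion, Set.mem_preimage, Finset.mem_range] at hx ⊢
        obtain ⟨j, hj, hjx⟩ := hx
        have hstep : ∀ i : ℤ, (T ^ i) (T x) = (T ^ (i + 1)) x := fun i => by
          rw [Homeomorph.zpow_add_apply', zpow_one]
        rcases j with _ | j
        · refine ⟨P - 1, by omega, ?_⟩
          rw [hstep, show (((P - 1 : ℕ) : ℤ) + 1) = P by omega, hPz]
          exact hY.mapsTo x (by simpa using hjx)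
        · refine ⟨j, by omega, ?_⟩
          rw [hstep]
          exact_mod_cast hjx
    intro x
    have := hS.ge (Set.mem_univ x)
    simp only [S, Set.mem_iUnion, Set.mem_preimage] at this
    obtain ⟨j, _, hj⟩ := this
    exact ⟨j, hj⟩
  choose j hj using hex
  have huniq : ∀ x (i k : ℤ), (T ^ i) x ∈ Y → ((T ^ k) x ∈ Y ↔ (d : ℤ) ∣ k - i) := by
    intro x i k hi
    have hx : (T ^ k) x = (T ^ (k - i)) ((T ^ i) x) := by
      rw [← Homeomorph.zpow_add_apply', sub_add_cancel]
    rw [hx, ← hmem]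
    exact ⟨fun h => key _ ⟨_, hi, h⟩, fun h => h _ hi⟩
  have hfib : ∀ x (k : ℤ), -((j x : ℤ) : ZMod d) = (k : ZMod d) ↔ (T ^ (-k)) x ∈ Y := by
    intro x k
    rw [huniq x (j x) (-k) (hj x), ← Int.cast_neg, ZMod.intCast_eq_intCast_iff_dvd_sub,
      show k - -j x = -(-k - j x) by ring, dvd_neg]
  have : NeZero d := ⟨hd0.ne'⟩
  -- The minus sign: `T` shortens by one the time `j x` needed to reach `Y`, while the factor has to
  -- increase.
  refine ⟨d, hd0, hdP, fun x hx k => (hmem _).2 (dvd_mul_right _ _) x hx,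
    fun x => -((j x : ℤ) : ZMod d), ?_, ?_, ?_⟩
  · refine continuous_of_isClosed_preimage_singleton fun c => ?_
    obtain ⟨k, rfl⟩ := ZMod.intCast_surjective c
    have : (fun x => -((j x : ℤ) : ZMod d)) ⁻¹' {(k : ZMod d)} = (T ^ (-k)) ⁻¹' Y := by
      ext x
      exact hfib x k
    rw [this]
    exact hY.isClosed.preimage (T ^ (-k)).continuous
  · intro x
    have h1 : (T ^ (j x - 1)) (T x) ∈ Y := by
      have := hj x
      rwa [show j x = (j x - 1) + 1 by ring, Homeomorph.zpow_add_apply', zpow_one] at this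
    have h2 := (hfib (T x) (1 - j x)).2 (by rwa [neg_sub])
    simp only
    rw [h2]
    push_cast
    ring
  · intro x
    simpa using hfib x 0

theorem exists_isMinimalOn [CompactSpace X] [Nonempty X] (g : X ≃ₜ X) :
    ∃ Y, IsMinimalOn g Y := by
  let F : Set (Set X) := {S | IsClosed S ∧ S.Nonempty ∧ ∀ x ∈ S, g x ∈ S}
  obtain ⟨m, -, hm⟩ := zorn_superset_nonempty F (by
    intro c hc hch hne
    have : Nonempty c := hne.to_subtype
    refine ⟨⋂₀ c, ⟨isClosed_sInter fun s hs => (hc hs).1, ?_, ?_⟩,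
      fun s hs => Set.sInter_subset_of_mem hs⟩
    · rw [Set.sInter_eq_iInter]
      refine IsCompact.nonempty_iInter_of_directed_nonempty_isCompact_isClosed _ ?_
        (fun i => (hc i.2).2.1) (fun i => (hc i.2).1.isCompact) fun i => (hc i.2).1
      intro a b
      rcases hch.total a.2 b.2 with h | h
      · exact ⟨a, subset_rfl, h⟩
      · exact ⟨b, h, subset_rfl⟩
    · exact fun x hx s hs => (hc hs).2.2 x (hx s hs))
    Set.univ ⟨isClosed_univ, Set.univ_nonempty, fun _ _ => trivial⟩
  exact ⟨m, hm.prop.2.1, hm.prop.1, hm.prop.2.2, fun S hS h1 h2 h3 =>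
    hm.eq_of_subset ⟨h1, h2, h3⟩ hS⟩

/-- For every `M` there is a cyclic factor of order dividing `M` whose fibres are the orbit
closures of `T ^ M`. -/
theorem IsMinimalOn.exists_cyclicFactor_closure [CompactSpace X] {T : X ≃ₜ X}
    (hT : IsMinimalOn T Set.univ) {M : ℕ} (hM : 0 < M) :
    ∃ d : ℕ, 0 < d ∧ d ∣ M ∧ ∃ f : X → ZMod d, Continuous f ∧ (∀ x, f (T x) = f x + 1) ∧
      ∀ x y, f x = f y → y ∈ closure (Set.range fun t : ℕ => (T ^ (M * t)) x) := by
  have : Nonempty X := hT.nonempty.to_type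
  obtain ⟨Y, hY⟩ := exists_isMinimalOn (T ^ M)
  obtain ⟨d, hd, hdM, -, f, hf, hfT, hfY⟩ := hT.exists_cyclicFactor hM hY
  refine ⟨d, hd, hdM, f, hf, hfT, fun x y hxy => ?_⟩
  have hz : ∀ (k : ℤ) x, f ((T ^ k) x) = f x + k := by
    have hn : ∀ (k : ℕ) x, f ((T ^ (k : ℤ)) x) = f x + k := by
      intro k
      induction k with
      | zero => simp
      | succ k ih =>
        intro x
        rw [Nat.cast_succ, Homeomorph.zpow_add_apply', ih, zpow_one, hfT]
        push_cast
        ring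
    intro k x
    obtain ⟨n, rfl | rfl⟩ := k.eq_nat_or_neg
    · simpa using hn n x
    · have := hn n ((T ^ (-(n : ℤ))) x)
      rw [← Homeomorph.zpow_add_apply', add_neg_cancel, zpow_zero] at this
      push_cast
      rw [show f x = _ from this]
      ring
  -- Both points are moved into `Y`, where forward orbits of `T ^ M` are dense, and moved back at
  -- the end.
  obtain ⟨k, hk⟩ := ZMod.intCast_surjective (-f x)
  have hx : (T ^ k) x ∈ Y := by rw [← hfY, hz, hk]; ring
  have hy : (T ^ k) y ∈ Y := by rw [← hfY, hz, hk, hxy]; ring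
  let S : Set X := closure (Set.range fun t : ℕ => (T ^ (M * t)) ((T ^ k) x))
  have hSY : S = Y := by
    refine hY.eq_of_subset S ?_ isClosed_closure
      ⟨_, subset_closure (Set.mem_range_self 0)⟩ ?_
    · refine closure_minimal ?_ hY.isClosed
      rintro _ ⟨t, rfl⟩
      induction t with
      | zero => simpa using hx
      | succ t ih =>
        have := hY.mapsTo _ ih
        simp only at this ⊢
        rwa [← Homeomorph.mul_apply, ← pow_add, add_comm, ← Nat.mul_succ] at this
    · intro z hz
      refine map_mem_closure (T ^ M).continuous hz ?_
      rintro _ ⟨t, rfl⟩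
      refine ⟨t + 1, ?_⟩
      simp only
      rw [Nat.mul_succ, add_comm, pow_add, Homeomorph.mul_apply]
  have hyS : (T ^ k) y ∈ S := hSY.ge hy
  have := map_mem_closure (t := Set.range fun t : ℕ => (T ^ (M * t)) x)
    (T ^ (-k)).continuous hyS (by
      rintro _ ⟨t, rfl⟩
      refine ⟨t, ?_⟩
      simp only
      rw [← zpow_natCast, ← Homeomorph.zpow_add_apply', ← Homeomorph.zpow_add_apply']
      congr 2
      ring)
  rw [← Homeomorph.zpow_add_apply'] at this
  simpa using this

end MinimalSystems

/-! ### Topology of the space of two-sided sequences -/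

namespace BiSeq

variable {α : Type u}

instance [Finite α] : CompactSpace (BiSeq α) := by
  let _ : TopologicalSpace α := ⊥
  exact inferInstanceAs (CompactSpace (ℤ → α))

instance : T2Space (BiSeq α) := by
  let _ : TopologicalSpace α := ⊥
  have _ : DiscreteTopology α := ⟨rfl⟩
  exact inferInstanceAs (T2Space (ℤ → α))

theorem isClopen_coord (i : ℤ) (s : Set α) : IsClopen {x : BiSeq α | x i ∈ s} := by
  let _ : TopologicalSpace α := ⊥
  have _ : DiscreteTopology α := ⟨rfl⟩
  exact (isClopen_discrete s).preimage (continuous_apply (A := fun _ : ℤ => α) i)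

theorem continuous_of_coord {Z : Type v} [TopologicalSpace Z] {f : Z → BiSeq α}
    (h : ∀ i (a : α), IsOpen {z | f z i = a}) : Continuous f := by
  let _ : TopologicalSpace α := ⊥
  have _ : DiscreteTopology α := ⟨rfl⟩
  refine continuous_pi (A := fun _ : ℤ => α) fun i => ?_
  exact continuous_discrete_rng.2 fun a => h i a

/-- A sequence that depends at each place on only one letter depends continuously on it. -/
theorem continuous_of_local {β : Type v} {f : BiSeq β → BiSeq α} (g : ℤ → ℤ) (φ : ℤ → β → α)
    (h : ∀ x i, f x i = φ i (x (g i))) : Continuous f := by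
  refine continuous_of_coord fun i a => ?_
  simp only [h]
  exact (isClopen_coord (g i) (φ i ⁻¹' {a})).isOpen

/-- Translation by `k`; for `k = 1` this is the shift. -/
def translate (k : ℤ) (x : BiSeq α) : BiSeq α := fun i => x (i + k)

theorem continuous_translate (k : ℤ) : Continuous (translate k : BiSeq α → BiSeq α) :=
  continuous_of_local (fun i => i + k) (fun _ a => a) fun _ _ => rfl

end BiSeq

/-! ### The level shifts as minimal homeomorphisms -/

namespace DirectiveSeq

variable (D : DirectiveSeq.{u})

theorem translate_mem_X (n : ℕ) {x : BiSeq (D.A n)} (hx : x ∈ D.X n) (k : ℤ) :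
    x.translate k ∈ D.X n := by
  intro i L
  convert hx (i + k) L using 2
  simp only [BiSeq.translate]
  ring_nf

/-- The shift of level `n` as a homeomorphism. -/
def levelShift (n : ℕ) : D.X n ≃ₜ D.X n where
  toFun x := ⟨x.1.shift, D.shift_mem_X n x.2⟩
  invFun x := ⟨x.1.translate (-1), D.translate_mem_X n x.2 (-1)⟩
  left_inv x := Subtype.ext <| funext fun i => by simp [BiSeq.shift, BiSeq.translate]
  right_inv x := Subtype.ext <| funext fun i => by simp [BiSeq.shift, BiSeq.translate]
  continuous_toFun :=
    ((BiSeq.continuous_translate 1).comp continuous_subtype_val).subtype_mk _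
  continuous_invFun :=
    ((BiSeq.continuous_translate (-1)).comp continuous_subtype_val).subtype_mk _

theorem levelShift_zpow_apply (n : ℕ) (k : ℤ) (x : D.X n) (i : ℤ) :
    ((D.levelShift n ^ k) x).1 i = x.1 (i + k) := by
  have h1 : ∀ (y : D.X n) i, (D.levelShift n y).1 i = y.1 (i + 1) := fun _ _ => rfl
  have h2 : ∀ (y : D.X n) i, ((D.levelShift n)⁻¹ y).1 i = y.1 (i + -1) := fun _ _ => rfl
  induction k generalizing x i with
  | zero => simp
  | succ k ih =>
    rw [zpow_add, Homeomorph.mul_apply, zpow_one, ih, h1]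
    ring_nf
  | pred k ih =>
    rw [zpow_sub, Homeomorph.mul_apply, zpow_one, ih, h2]
    ring_nf

theorem levelShift_pow_apply (n k : ℕ) (x : D.X n) (i : ℤ) :
    ((D.levelShift n ^ k) x).1 i = x.1 (i + k) := by
  rw [← D.levelShift_zpow_apply, zpow_natCast]

theorem TorsionFree.compactSpace {D : DirectiveSeq.{u}} (hD : D.TorsionFree) (n : ℕ) :
    CompactSpace (D.X n) := by
  have := D.finite n
  exact isCompact_iff_compactSpace.1 (hD.minimal n).2.1.isCompact

theorem TorsionFree.nonempty {D : DirectiveSeq.{u}} (hD : D.TorsionFree) (n : ℕ) :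
    Nonempty (D.X n) := (hD.minimal n).1.to_subtype

theorem TorsionFree.isMinimalOn {D : DirectiveSeq.{u}} (hD : D.TorsionFree) (n : ℕ) :
    IsMinimalOn (D.levelShift n) Set.univ := by
  have := hD.compactSpace n
  have := hD.nonempty n
  refine IsMinimalOn.of_invariant _ fun S hS hne hinv => ?_
  have hcl : IsClosed (Subtype.val '' S) := hS.trans (hD.minimal n).2.1
  rcases (hD.minimal n).2.2.2 (Subtype.val '' S) (by simp) hcl (by
    ext x
    constructor
    · rintro ⟨y, hy, hyx⟩
      have hx : x ∈ D.X n := by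
        rw [← (hD.minimal n).2.2.1, Set.mem_preimage, ← hyx]
        exact y.2
      refine ⟨⟨x, hx⟩, ?_, rfl⟩
      rw [← hinv]
      have : D.levelShift n ⟨x, hx⟩ = y := Subtype.ext hyx.symm
      rwa [Set.mem_preimage, this]
    · rintro ⟨y, hy, rfl⟩
      rw [← hinv] at hy
      exact ⟨_, hy, rfl⟩) with h | h
  · rw [Set.image_eq_empty] at h
    exact absurd h hne.ne_empty
  · rw [Set.eq_univ_iff_forall]
    intro x
    have := h.ge x.2
    simpa using this

/-! ### Desubstitution -/

/-- Needed because `n + 1 + k` and `n + (k + 1)` index alphabets that are equal but not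
definitionally so. -/
theorem theta_heq {m M : ℕ} (h : m = M) {a : D.A (m + 1)} {b : D.A (M + 1)} (hab : HEq a b)
    {j : ℕ} (hj : j < D.q m) (hj' : j < D.q M) : HEq (D.θ m a ⟨j, hj⟩) (D.θ M b ⟨j, hj'⟩) := by
  subst h
  rw [eq_of_heq hab]

theorem len_succ' (n k : ℕ) : D.len n (k + 1) = D.q n * D.len (n + 1) k := by
  unfold len
  rw [Finset.prod_range_succ', mul_comm, Nat.add_zero]
  congr 1
  exact Finset.prod_congr rfl fun i _ => by congr 1; ring

/-- `comp` is defined by splitting off the last morphism; desubstitution requires splitting off the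
outermost one, `θ n`. -/
theorem comp_succ_left (n k : ℕ) (a : D.A (n + 1 + k)) (b : D.A (n + (k + 1))) (hab : HEq a b)
    (j : ℕ) (hj : j < D.len n (k + 1)) (hj' : j / D.q n < D.len (n + 1) k) :
    D.comp n (k + 1) b ⟨j, hj⟩ =
      D.θ n (D.comp (n + 1) k a ⟨j / D.q n, hj'⟩) ⟨j % D.q n, Nat.mod_lt _ (D.q_pos n)⟩ := by
  induction k generalizing j with
  | zero =>
    obtain rfl : a = b := eq_of_heq hab
    have h1 : D.len n 0 = 1 := rfl
    have h2 : D.len n 1 = D.q n := by simp [len]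
    have hj2 : j < D.q n := h2 ▸ hj
    simp only [comp, h1, Nat.div_one]
    congr 1
    exact Fin.ext (Nat.mod_eq_of_lt hj2).symm
  | succ k ih =>
    rw [comp]
    have hqd : D.len n (k + 1) = D.q n * D.len (n + 1) k := D.len_succ' n k
    have hlt : j / D.len n (k + 1) < D.q (n + (k + 1)) :=
      Nat.div_lt_of_lt_mul (D.len_succ n (k + 1) ▸ hj)
    have hlt' : j / D.len n (k + 1) < D.q (n + 1 + k) := by
      rwa [show n + 1 + k = n + (k + 1) by ring]
    have hm : j % D.len n (k + 1) / D.q n = j / D.q n % D.len (n + 1) k := by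
      rw [hqd, Nat.mod_mul_right_div_self]
    refine (ih (D.θ (n + 1 + k) a ⟨j / D.len n (k + 1), hlt'⟩) _
      (D.theta_heq (Nat.add_right_comm n 1 k) hab hlt' hlt) _ _
      (by rw [hm]; exact Nat.mod_lt _ (D.len_pos _ _))).trans ?_
    have hd : j / D.len n (k + 1) = j / D.q n / D.len (n + 1) k := by
      rw [hqd, Nat.div_div_eq_div_mul]
    conv_rhs => rw [comp]
    simp only [hm, hd]
    congr 1
    exact Fin.ext (by rw [hqd]; exact Nat.mod_mul_right_mod _ _ _)

theorem apply_mem_X (n : ℕ) {x : BiSeq (D.A (n + 1))} (hx : x ∈ D.X (n + 1)) :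
    D.apply n x ∈ D.X n := by
  intro i L
  have hq := D.q_pos n
  have hqz : (0 : ℤ) < D.q n := by exact_mod_cast hq
  -- `L` consecutive letters of the image meet at most `L + 1` of the words `θ n (x i)`, since the
  -- first may be cut.
  obtain ⟨k, hk, a, j, hj, h⟩ := hx (i / D.q n) (L + 1)
  obtain ⟨b, hab⟩ : ∃ b : D.A (n + (k + 1)), HEq a b :=
    ⟨(congrArg D.A (by ring : n + 1 + k = n + (k + 1))) ▸ a, by simp⟩
  set r := (i % D.q n).toNat with hr
  have hrz : (r : ℤ) = i % D.q n := Int.toNat_of_nonneg (Int.emod_nonneg _ hqz.ne')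
  have hrq : r < D.q n := by
    have := Int.emod_lt_of_pos i hqz
    omega
  have hi : i = D.q n * (i / D.q n) + r := by rw [hrz]; exact (Int.mul_ediv_add_emod _ _).symm
  have hlen := D.len_succ' n k
  have hbound : ∀ t < L, r + t < D.q n * (L + 1) := by
    intro t ht
    have : L ≤ D.q n * L := Nat.le_mul_of_pos_left _ hq
    rw [Nat.mul_succ]
    omega
  refine ⟨k + 1, Nat.succ_pos k, b, D.q n * j + r, ?_, ?_⟩
  · rw [hlen]
    refine le_trans ?_ (Nat.mul_le_mul_left _ hj)
    rw [Nat.mul_add]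
    rcases Nat.eq_zero_or_pos L with rfl | hL
    · rw [zero_add, mul_one]; omega
    · have := hbound (L - 1) (by omega)
      omega
  · intro t
    have hdiv : (D.q n * j + r + t) / D.q n = j + (r + t) / D.q n := by
      rw [add_assoc, Nat.mul_add_div hq]
    have hlt : (r + t) / D.q n < L + 1 := Nat.div_lt_of_lt_mul (hbound t t.2)
    rw [D.comp_succ_left n k a b hab _ _ (by rw [hdiv]; omega)]
    have hmod : (D.q n * j + r + t) % D.q n = (r + t) % D.q n := by
      rw [add_assoc, Nat.mul_add_mod]
    have hit : i + (t : ℕ) = D.q n * (i / D.q n) + ((r + t : ℕ) : ℤ) := by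
      push_cast
      linarith
    have e1 : (i + (t : ℕ)) / (D.q n : ℤ) = i / D.q n + ((r + t) / D.q n : ℕ) := by
      rw [hit, Int.mul_add_ediv_left _ _ hqz.ne']
      norm_cast
    have e2 : ((i + (t : ℕ)) % (D.q n : ℤ)).toNat = (r + t) % D.q n := by
      rw [hit, Int.mul_add_emod_self_left]
      norm_cast
    simp only [apply, e1, e2, hdiv, hmod]
    congr 1
    exact h ⟨(r + t) / D.q n, hlt⟩

theorem continuous_apply_level (n : ℕ) : Continuous (D.apply n) :=
  BiSeq.continuous_of_local (fun i => i / D.q n) (fun i a => D.θ n a ⟨(i % (D.q n : ℤ)).toNat, by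
    have h : (0 : ℤ) < D.q n := by exact_mod_cast D.q_pos n
    have h1 := Int.emod_nonneg i h.ne'
    have h2 := Int.emod_lt_of_pos i h
    omega⟩) fun _ _ => rfl

/-- Any point of `X^(N)` can be pushed down to all lower levels; compactness of the product turns
these finite chains into an infinite one. -/
theorem TorsionFree.nonempty_limitWord {D : DirectiveSeq.{u}} (hD : D.TorsionFree) :
    Nonempty D.LimitWord := by
  have hfin : ∀ n, Finite (D.A n) := D.finite
  let C : ℕ → Set (∀ n, BiSeq (D.A n)) := fun N =>
    {v | (∀ n, v n ∈ D.X n) ∧ ∀ n < N, D.apply n (v (n + 1)) = v n}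
  have hcl : ∀ N, IsClosed (C N) := fun N => by
    simp only [C, Set.ofPred_and, Set.ofPred_forall]
    refine IsClosed.inter ?_ ?_
    · exact isClosed_iInter fun n => (hD.minimal n).2.1.preimage (continuous_apply n)
    · exact isClosed_iInter fun n => isClosed_iInter fun _ =>
        isClosed_eq ((D.continuous_apply_level n).comp (continuous_apply (n + 1)))
          (continuous_apply n)
  have hext : ∀ N, ∀ y ∈ D.X N, ∃ v ∈ C N, v N = y := by
    intro N
    induction N with
    | zero =>
      intro y hy
      refine ⟨Function.update (fun n => (hD.nonempty n).some.1) 0 y, ⟨fun n => ?_, by simp⟩,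
        by simp⟩
      rcases n with _ | n
      · simpa using hy
      · rw [Function.update_of_ne (by simp)]
        exact (hD.nonempty (n + 1)).some.2
    | succ N ih =>
      intro y hy
      obtain ⟨v, ⟨hv1, hv2⟩, hv⟩ := ih _ (D.apply_mem_X N hy)
      refine ⟨Function.update v (N + 1) y, ⟨fun n => ?_, fun n hn => ?_⟩, by simp⟩
      · rcases eq_or_ne n (N + 1) with rfl | h
        · simpa using hy
        · rw [Function.update_of_ne h]
          exact hv1 n
      · rcases Nat.lt_succ_iff_lt_or_eq.1 hn with h | rfl
        · rw [Function.update_of_ne (by omega), Function.update_of_ne (by omega), hv2 n h]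
        · rw [Function.update_self, Function.update_of_ne (by omega), hv]
  obtain ⟨v, hv⟩ := IsCompact.nonempty_iInter_of_directed_nonempty_isCompact_isClosed C
    (directed_of_isDirected_le fun a b hab v hv =>
      ⟨hv.1, fun n hn => hv.2 n (lt_of_lt_of_le hn hab)⟩)
    (fun N => by
      obtain ⟨v, hv, -⟩ := hext N _ (hD.nonempty N).some.2
      exact ⟨v, hv⟩)
    (fun N => (hcl N).isCompact) hcl
  rw [Set.mem_iInter] at hv
  exact ⟨⟨v, (hv 0).1, fun n => (hv (n + 1)).2 n (Nat.lt_succ_self n)⟩⟩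

/-- The action of `θ^[0, N)` on two-sided sequences. -/
def applyIter : ∀ N, BiSeq (D.A N) → BiSeq (D.A 0)
  | 0 => id
  | N + 1 => applyIter N ∘ D.apply N

/-- The length of `θ^[0, n)`. -/
def totalLen (n : ℕ) : ℕ := ∏ i ∈ Finset.range n, D.q i

theorem totalLen_pos (n : ℕ) : 0 < D.totalLen n := Finset.prod_pos fun i _ => D.q_pos i

theorem totalLen_succ (n : ℕ) : D.totalLen (n + 1) = D.totalLen n * D.q n :=
  Finset.prod_range_succ _ _

theorem totalLen_dvd {m n : ℕ} (h : m ≤ n) : D.totalLen m ∣ D.totalLen n :=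
  Finset.prod_dvd_prod_of_subset _ _ _ (by simpa using h)

theorem applyIter_mem_X (N : ℕ) {x : BiSeq (D.A N)} (hx : x ∈ D.X N) :
    D.applyIter N x ∈ D.X 0 := by
  induction N with
  | zero => exact hx
  | succ N ih => exact ih (D.apply_mem_X N hx)

/-- The form in which `θ^[0,N)` is used below: a letter of the image depends on one letter of `x`
and on the place modulo `p_N`. -/
theorem exists_applyIter_eq (N : ℕ) : ∃ W : D.A N → ℤ → D.A 0, ∀ x i,
    D.applyIter N x i = W (x (i / D.totalLen N)) (i % D.totalLen N) := by
  induction N with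
  | zero => exact ⟨fun a _ => a, fun x i => by simp [applyIter, totalLen]⟩
  | succ N ih =>
    obtain ⟨W, hW⟩ := ih
    have hP : (0 : ℤ) < D.totalLen N := by exact_mod_cast D.totalLen_pos N
    have hq : (0 : ℤ) < D.q N := by exact_mod_cast D.q_pos N
    refine ⟨fun a r => W (D.θ N a ⟨(r / D.totalLen N % (D.q N : ℤ)).toNat, by
      have h1 := Int.emod_nonneg (r / D.totalLen N) hq.ne'
      have h2 := Int.emod_lt_of_pos (r / D.totalLen N) hq
      omega⟩) (r % D.totalLen N), fun x i => ?_⟩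
    simp only [applyIter, Function.comp_apply]
    rw [hW]
    have hlen : (D.totalLen (N + 1) : ℤ) = D.totalLen N * D.q N := by
      exact_mod_cast D.totalLen_succ N
    have e1 : i % D.totalLen (N + 1) % D.totalLen N = i % D.totalLen N := by
      rw [hlen]
      exact Int.emod_emod_of_dvd _ (dvd_mul_right _ _)
    have e2 : i / D.totalLen (N + 1) = i / D.totalLen N / D.q N := by
      rw [hlen, Int.ediv_ediv_of_nonneg hP.le]
    have e3 : i % D.totalLen (N + 1) / D.totalLen N % D.q N = i / D.totalLen N % D.q N := by
      have : i % D.totalLen (N + 1)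
          = i + D.totalLen N * (D.q N * -(i / D.totalLen (N + 1))) := by
        rw [Int.emod_def]
        conv_lhs => rw [hlen]
        rw [hlen]
        ring
      rw [this, Int.add_mul_ediv_left _ _ hP.ne', Int.add_mul_emod_self_left]
    simp only [e1, e2, e3, apply]

/-- The map `X^(N) → X^(0)` induced by `θ^[0, N)`. -/
def levelMap (N : ℕ) (x : D.X N) : D.X 0 := ⟨D.applyIter N x.1, D.applyIter_mem_X N x.2⟩

theorem continuous_levelMap (N : ℕ) : Continuous (D.levelMap N) := by
  obtain ⟨W, hW⟩ := D.exists_applyIter_eq N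
  refine Continuous.subtype_mk (Continuous.comp ?_ continuous_subtype_val) _
  exact BiSeq.continuous_of_local _ (fun i a => W a (i % D.totalLen N)) hW

theorem levelMap_shift (N : ℕ) (x : D.X N) :
    D.levelMap N (D.levelShift N x) = (D.levelShift 0 ^ D.totalLen N) (D.levelMap N x) := by
  obtain ⟨W, hW⟩ := D.exists_applyIter_eq N
  have hP : (D.totalLen N : ℤ) ≠ 0 := by exact_mod_cast (D.totalLen_pos N).ne'
  refine Subtype.ext (funext fun i => ?_)
  rw [levelShift_pow_apply]
  simp only [levelMap]
  rw [hW, hW, Int.add_emod_right, Int.add_ediv_of_dvd_right (dvd_refl _), Int.ediv_self hP]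
  rfl

/-- `levelMap` carries the shift of `X^(N)` to `T ^ p_N`, so closed invariant subsets of the range
pull back to such subsets of the minimal system `X^(N)`. -/
theorem TorsionFree.isMinimalOn_range {D : DirectiveSeq.{u}} (hD : D.TorsionFree) (N : ℕ) :
    IsMinimalOn (D.levelShift 0 ^ D.totalLen N) (Set.range (D.levelMap N)) := by
  have := hD.compactSpace N
  have := hD.nonempty N
  refine ⟨Set.range_nonempty _, (isCompact_range (D.continuous_levelMap N)).isClosed, ?_, ?_⟩
  · rintro _ ⟨x, rfl⟩
    exact ⟨_, D.levelMap_shift N x⟩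
  · rintro S hS hcl ⟨y, hy⟩ hinv
    obtain ⟨x, rfl⟩ := hS hy
    have := (hD.isMinimalOn N).eq_of_subset (D.levelMap N ⁻¹' S) (Set.subset_univ _)
      (hcl.preimage (D.continuous_levelMap N)) ⟨x, hy⟩ (fun z hz => by
        rw [Set.mem_preimage, levelMap_shift]
        exact hinv _ hz)
    refine hS.antisymm ?_
    rintro _ ⟨z, rfl⟩
    exact this.ge (Set.mem_univ z)

theorem TorsionFree.tendsto_totalLen {D : DirectiveSeq.{u}} (hD : D.TorsionFree) (B : ℕ) :
    ∃ n, B ≤ D.totalLen n := by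
  induction B with
  | zero => exact ⟨0, Nat.zero_le _⟩
  | succ B ih =>
    obtain ⟨n, hn⟩ := ih
    obtain ⟨k, hk, hnk⟩ := hD.infinite_length.exists_gt n
    refine ⟨k + 1, ?_⟩
    rw [totalLen_succ]
    have h1 := Nat.le_of_dvd (D.totalLen_pos k) (D.totalLen_dvd hnk.le)
    have h2 := D.totalLen_pos k
    simp only [Set.mem_ofPred_eq] at hk
    nlinarith

theorem totalLen_mono : Monotone D.totalLen := fun _ _ h =>
  Nat.le_of_dvd (D.totalLen_pos _) (D.totalLen_dvd h)

end DirectiveSeq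

/-! ### Return times of the images and the odometer factor -/

theorem BiSeq.iterate_shift_apply {α : Type u} (k : ℕ) (x : BiSeq α) (i : ℤ) :
    BiSeq.shift^[k] x i = x (i + k) := by
  induction k generalizing i with
  | zero => simp
  | succ k ih =>
    rw [Function.iterate_succ_apply', BiSeq.shift, ih]
    push_cast
    ring_nf

/-- Among `K + 1` objects in at most `K` colours two have the same colour. -/
theorem exists_lt_map_eq_of_card_le {α : Type u} [Finite α] {K : ℕ} (hK : Nat.card α ≤ K)
    (c : ℕ → α) : ∃ e f, e < f ∧ f ≤ K ∧ c e = c f := by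
  have := Fintype.ofFinite α
  obtain ⟨a, b, hab, h⟩ := Fintype.exists_ne_map_eq_of_card_lt (fun i : Fin (K + 1) => c i)
    (by rw [← Nat.card_eq_fintype_card, Fintype.card_fin]; omega)
  have ha := a.2
  have hb := b.2
  rcases lt_or_gt_of_ne (fun h => hab (Fin.ext h) : (a : ℕ) ≠ b) with h1 | h1
  · exact ⟨a, b, h1, by omega, h⟩
  · exact ⟨b, a, h1, by omega, h.symm⟩

namespace DirectiveSeq

variable {D : DirectiveSeq.{u}}

/-- If the return times of the image are all multiples of `d` and `p_N` is too long, two of `K + 1`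
successive words of length `p_N` coincide near every place. Each coincidence is a local period
dividing `K! d` on a stretch longer than `K! d`, so the point would be periodic. -/
theorem TorsionFree.totalLen_lt (hD : D.TorsionFree) {K : ℕ} (N : ℕ)
    (hK : Nat.card (D.A N) ≤ K) {d : ℕ} (hd : 0 < d)
    (hY : ∀ x ∈ Set.range (D.levelMap N), ∀ k : ℤ,
      (D.levelShift 0 ^ (d * k)) x ∈ Set.range (D.levelMap N)) :
    D.totalLen N < (K + 1 + K.factorial) * d := by
  by_contra! hcon
  have := D.finite N
  obtain ⟨W, hW⟩ := D.exists_applyIter_eq N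
  set P := D.totalLen N with hP
  set x := D.levelMap N (hD.nonempty N).some with hx
  choose y hy using fun k : ℤ => hY x ⟨_, rfl⟩ k
  have hsame : ∀ a b : ℤ, (y a).1 0 = (y b).1 0 → ∀ s : ℤ, 0 ≤ s → s < P →
      x.1 (s + d * a) = x.1 (s + d * b) := by
    intro a b hab s hs0 hsP
    have h : ∀ a : ℤ, x.1 (s + d * a) = W ((y a).1 0) (s % P) := fun a => by
      rw [← levelShift_zpow_apply, ← hy a]
      simp only [levelMap]
      rw [hW, Int.ediv_eq_zero_of_lt hs0 hsP]
    rw [h, h, hab]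
  have hper : ∀ t : ℤ, x.1 (t + (K.factorial * d : ℕ)) = x.1 t := by
    intro t
    have hdz : (0 : ℤ) < d := by exact_mod_cast hd
    -- The candidates are the starting places `d i, …, d (i + K)`, none of them beyond `t`.
    set i : ℤ := t / d - K with hi
    obtain ⟨e, f, hef, hfK, hc⟩ := exists_lt_map_eq_of_card_le hK
      (fun a : ℕ => (y (i + a)).1 0)
    obtain ⟨m, hm⟩ : f - e ∣ K.factorial := Nat.dvd_factorial (by omega) (by omega)
    have h1 : ∀ s : ℤ, d * (i + e) ≤ s → s < d * (i + e) + P →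
        x.1 s = x.1 (s + d * (f - e : ℕ)) := by
      intro s h1 h2
      have := hsame _ _ hc (s - d * (i + e)) (by linarith) (by linarith)
      rw [sub_add_cancel] at this
      rw [this, Nat.cast_sub hef.le]
      ring_nf
    have hlow : d * (i + e) ≤ t := by
      have h2 := Int.mul_ediv_self_le (x := t) hdz.ne'
      have h3 : (e : ℤ) ≤ K := by exact_mod_cast (by omega : e ≤ K)
      have h4 : i + e ≤ t / d := by rw [hi]; linarith
      calc (d : ℤ) * (i + e) ≤ d * (t / d) := mul_le_mul_of_nonneg_left h4 hdz.le
        _ ≤ t := h2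
    -- Here the constant `K + 1 + K!` is used up: `K + 1` for the distance from the start to `t`,
    -- `K!` for the distance to `t + K! d`.
    have hupp : t + d * K.factorial < d * (i + e) + P := by
      have h2 := Int.lt_mul_ediv_self_add (x := t) hdz
      have h3 : ((K : ℤ) + 1 + K.factorial) * d ≤ P := by exact_mod_cast hcon
      have h4 : (0 : ℤ) ≤ d * e := by positivity
      rw [hi]
      nlinarith
    have h2 : ∀ j : ℕ, j ≤ m → x.1 (t + d * ((f - e : ℕ) * j)) = x.1 t := by
      intro j
      induction j with
      | zero => simp
      | succ j ih =>
        intro hj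
        rw [← ih (by omega), h1 (t + d * ((f - e : ℕ) * j))]
        · push_cast
          ring_nf
        · have : (0 : ℤ) ≤ d * ((f - e : ℕ) * j) := by positivity
          linarith
        · refine lt_of_le_of_lt ?_ hupp
          have : ((f - e : ℕ) : ℤ) * j ≤ K.factorial := by
            rw [hm]
            push_cast
            exact_mod_cast Nat.mul_le_mul_left _ (by omega)
          have := mul_le_mul_of_nonneg_left this hdz.le
          linarith
    have := h2 m le_rfl
    rw [← this]
    rw [hm]
    push_cast
    ring_nf
  refine hD.aperiodic x.1 x.2 (K.factorial * d) (by positivity) (funext fun t => ?_)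
  rw [BiSeq.iterate_shift_apply, hper]

theorem TorsionFree.exists_pow_dvd_totalLen (hD : D.TorsionFree) {p : ℕ} (hp : p.Prime) {k : ℕ}
    (hk : p ∣ D.q k) (e : ℕ) : ∃ N, p ^ e ∣ D.totalLen N := by
  induction e with
  | zero => exact ⟨0, by simp⟩
  | succ e ih =>
    obtain ⟨N, hN⟩ := ih
    obtain ⟨n, hn, hNn⟩ := (hD.prime_dvd p hp k hk).exists_gt N
    refine ⟨n + 1, ?_⟩
    rw [totalLen_succ, pow_succ]
    exact mul_dvd_mul (hN.trans (D.totalLen_dvd hNn.le)) hn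

theorem exists_dvd_q_of_dvd_totalLen {p : ℕ} (hp : p.Prime) {n : ℕ} (h : p ∣ D.totalLen n) :
    ∃ k, p ∣ D.q k := by
  obtain ⟨k, -, hk⟩ := (hp.prime.dvd_finsetProd_iff _).1 h
  exact ⟨k, hk⟩

/-- Quasi-recognizability: the odometer of the length sequence is a factor. -/
theorem TorsionFree.hasCyclicFactor_totalLen (hD : D.TorsionFree) (hb : D.BoundedAlphabets)
    (n : ℕ) : HasCyclicFactor (D.levelShift 0) (D.totalLen n) := by
  obtain ⟨K, hK⟩ := hb
  refine HasCyclicFactor.of_prime_pow (D.totalLen_pos n).ne' fun p hp hpn e => ?_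
  obtain ⟨k, hk⟩ := exists_dvd_q_of_dvd_totalLen hp hpn
  set C := K + 1 + K.factorial with hC
  -- The surplus exponent `C` pays for the index `m = p_N / d`: as `m < C < p ^ C`, the prime power
  -- left in `d` is at least `p ^ e`.
  obtain ⟨N, hN⟩ := hD.exists_pow_dvd_totalLen hp hk (e + C)
  obtain ⟨d, hd, ⟨m, hm⟩, hY, f, hf, hfT, -⟩ :=
    (hD.isMinimalOn 0).exists_cyclicFactor (D.totalLen_pos N) (hD.isMinimalOn_range N)
  have hlt := hD.totalLen_lt N (hK N) hd hY
  have hmC : m < C := by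
    rw [hm, mul_comm] at hlt
    exact lt_of_mul_lt_mul_right hlt (Nat.zero_le _)
  have hm0 : m ≠ 0 := by
    rintro rfl
    exact (D.totalLen_pos N).ne' (by simpa using hm)
  refine HasCyclicFactor.of_dvd (k := d) ⟨f, hf, hfT⟩ ?_
  have hpm : ¬ p ^ C ∣ m := fun h => by
    have h1 := Nat.le_of_dvd (Nat.pos_of_ne_zero hm0) h
    have h2 := Nat.lt_pow_self (n := C) hp.one_lt
    omega
  by_contra hcon
  have hed : ¬ e ≤ padicValNat p d := fun h => hcon ((padicValNat_dvd_iff_le (hp := ⟨hp⟩) hd.ne').2 h)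
  have hem : ¬ C ≤ padicValNat p m := fun h => hpm ((padicValNat_dvd_iff_le (hp := ⟨hp⟩) hm0).2 h)
  rw [hm, padicValNat_dvd_iff_le (hp := ⟨hp⟩) (mul_ne_zero hd.ne' hm0),
    padicValNat.mul (hp := ⟨hp⟩) hd.ne' hm0] at hN
  omega

end DirectiveSeq

/-! ### Iterated sumsets -/

/-- The sums of `i` elements of `S`. -/
def iteratedSum (S : Set ℤ) : ℕ → Set ℤ
  | 0 => {0}
  | i + 1 => {a | ∃ b ∈ iteratedSum S i, a - b ∈ S}

/-- If `S` contains the differences of equally coloured integers, for a colouring with `K` colours,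
then the multiples of `K!` are sums of `2 K + 1` elements of `S`. -/
theorem factorial_mul_mem_iteratedSum {α : Type u} [Finite α] {K : ℕ} (hK : Nat.card α ≤ K)
    (c : ℤ → α) {S : Set ℤ} (hneg : ∀ s ∈ S, -s ∈ S) (hc : ∀ s t, c s = c t → s - t ∈ S) (t : ℤ) :
    K.factorial * t ∈ iteratedSum S (2 * K + 1) := by
  have h0 : (0 : ℤ) ∈ S := by simpa using hc 0 0 rfl
  have hmono : Monotone (iteratedSum S) :=
    monotone_nat_of_le_succ fun i a ha => ⟨a, ha, by simpa using h0⟩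
  have hzero : ∀ i, (0 : ℤ) ∈ iteratedSum S i := fun i => hmono (Nat.zero_le i) rfl
  -- The colour sets of the even iterated sums increase, start non-empty and have at most `K`
  -- elements.
  obtain ⟨i, hi, hstab⟩ : ∃ i < K, c '' iteratedSum S (2 * i) = c '' iteratedSum S (2 * i + 2) := by
    by_contra! hcon
    have hcard : ∀ i ≤ K, i + 1 ≤ (c '' iteratedSum S (2 * i)).ncard := by
      intro i
      induction i with
      | zero => exact fun _ => (Set.ncard_pos).2 ⟨_, 0, hzero _, rfl⟩
      | succ i ih =>
        intro hi
        have hss : c '' iteratedSum S (2 * i) ⊂ c '' iteratedSum S (2 * i + 2) :=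
          (Set.image_mono (hmono (by omega))).ssubset_of_ne (hcon i (by omega))
        have := Set.ncard_lt_ncard hss
        have := ih (by omega)
        rw [show 2 * (i + 1) = 2 * i + 2 by ring]
        omega
    have h1 := hcard K le_rfl
    have h2 := Set.ncard_le_card (c '' iteratedSum S (2 * K))
    omega
  -- A sum of `2 i + 2` elements has the colour of some sum of `2 i` elements, hence differs from it
  -- by one element of `S`.
  have hclosed : ∀ a ∈ iteratedSum S (2 * i + 1), ∀ s ∈ S,
      a + s ∈ iteratedSum S (2 * i + 1) := by
    intro a ha s hs
    have h1 : a + s ∈ iteratedSum S (2 * i + 2) := ⟨a, ha, by simpa using hs⟩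
    have h2 : c (a + s) ∈ c '' iteratedSum S (2 * i) := by
      rw [hstab]
      exact ⟨_, h1, rfl⟩
    obtain ⟨b, hb, hbc⟩ := h2
    exact ⟨b, hb, hc _ _ hbc.symm⟩
  refine hmono (by omega : 2 * i + 1 ≤ 2 * K + 1) ?_
  -- Pigeonhole on `0, …, K` gives an element `r` of `S` that divides `K!`.
  obtain ⟨e, f, hef, hfK, hcef⟩ := exists_lt_map_eq_of_card_le hK (fun n : ℕ => c n)
  obtain ⟨m, hm⟩ : f - e ∣ K.factorial := Nat.dvd_factorial (by omega) (by omega)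
  set r : ℤ := ((f - e : ℕ) : ℤ) with hr
  have hrS : r ∈ S := by
    rw [hr, Nat.cast_sub hef.le]
    exact hc _ _ hcef.symm
  have key : ∀ n : ℤ, r * n ∈ iteratedSum S (2 * i + 1) := by
    intro n
    induction n with
    | zero => simpa using hzero _
    | succ n ih =>
      have := hclosed _ ih r hrS
      rwa [← mul_add_one] at this
    | pred n ih =>
      have := hclosed _ ih (-r) (hneg _ hrS)
      rwa [← sub_eq_add_neg, ← mul_sub_one] at this
  have := key (m * t)
  rw [hm]
  push_cast
  rwa [mul_assoc]

/-! ### Almost periods in equicontinuous factors -/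

open Uniformity

namespace DirectiveSeq

variable {D : DirectiveSeq.{u}}

/-- The sets of pairs agreeing on `[-L, L]` are compact and decrease to the diagonal. -/
theorem TorsionFree.exists_agree_subset (hD : D.TorsionFree) {O : Set (D.X 0 × D.X 0)}
    (hO : ∀ x, O ∈ nhds (x, x)) :
    ∃ L : ℕ, ∀ x y : D.X 0, (∀ i : ℤ, -L ≤ i → i ≤ L → x.1 i = y.1 i) → (x, y) ∈ O := by
  have := hD.compactSpace 0
  let V : ℕ → Set (D.X 0 × D.X 0) := fun L =>
    {p | ∀ i : ℤ, -L ≤ i → i ≤ L → p.1.1 i = p.2.1 i}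
  have hcl : ∀ L, IsClosed (V L) := fun L => by
    simp only [V, Set.ofPred_forall]
    refine isClosed_iInter fun i => isClosed_iInter fun _ => isClosed_iInter fun _ => ?_
    have : {p : D.X 0 × D.X 0 | p.1.1 i = p.2.1 i} =
        ⋃ a : D.A 0, {p | p.1.1 i ∈ ({a} : Set _)} ∩ {p | p.2.1 i ∈ ({a} : Set _)} := by
      ext p
      simp only [Set.mem_ofPred_eq, Set.mem_iUnion, Set.mem_inter_iff, Set.mem_singleton_iff]
      exact ⟨fun h => ⟨_, h, rfl⟩, fun ⟨a, h1, h2⟩ => h1.trans h2.symm⟩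
    rw [this]
    have := D.finite 0
    refine isClosed_iUnion_of_finite fun a => IsClosed.inter ?_ ?_
    · exact (BiSeq.isClopen_coord i {a}).isClosed.preimage
        (continuous_subtype_val.comp continuous_fst)
    · exact (BiSeq.isClopen_coord i {a}).isClosed.preimage
        (continuous_subtype_val.comp continuous_snd)
  obtain ⟨L, hL⟩ := exists_subset_nhds_of_isCompact' (V := V)
    (directed_of_isDirected_le fun a b hab p hp i h1 h2 => hp i (by omega) (by omega))
    (fun L => (hcl L).isCompact) hcl (U := O) (by
      rintro ⟨x, y⟩ hxy
      rw [Set.mem_iInter] at hxy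
      have : x = y := Subtype.ext <| funext fun i =>
        hxy i.natAbs i (by omega) (by omega)
      rw [← this]
      exact hO x)
  exact ⟨L, fun x y h => hL h⟩

/-- In an equicontinuous factor the iterates of `T` at the multiples of `K! p_n` are uniformly
close to the identity, for large `n`. -/
theorem TorsionFree.exists_close_iterates (hD : D.TorsionFree) {K : ℕ}
    (hK : ∀ n, Nat.card (D.A n) ≤ K) {Y : Type v} [UniformSpace Y] {ρ : D.X 0 → Y}
    (hρ : Continuous ρ)
    (hE : ∀ U ∈ 𝓤 Y, ∃ V ∈ 𝓤 Y, ∀ x y, (ρ x, ρ y) ∈ V →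
      ∀ k : ℤ, (ρ ((D.levelShift 0 ^ k) x), ρ ((D.levelShift 0 ^ k) y)) ∈ U)
    {U : Set (Y × Y)} (hU : U ∈ 𝓤 Y) (hUcl : IsClosed U) :
    ∃ n, ∀ x, ∀ t : ℕ,
      (ρ x, ρ ((D.levelShift 0 ^ (K.factorial * D.totalLen n * t)) x)) ∈ U := by
  set T := D.levelShift 0 with hT
  obtain ⟨V, ⟨hV, hVU⟩, hVsymm⟩ : ∃ V, (V ∈ 𝓤 Y ∧
      (fun W => SetRel.comp V W)^[2 * K + 1] V ⊆ U) ∧ SetRel.IsSymm V := by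
    obtain ⟨V', hV', h⟩ :=
      Filter.eventually_smallSets.1 (eventually_uniformity_iterate_comp_subset hU (2 * K + 1))
    obtain ⟨V, hV, hsymm, hVV'⟩ := symm_of_uniformity hV'
    exact ⟨V, ⟨hV, h V hVV'⟩, hsymm⟩
  obtain ⟨W, hW, hWV⟩ := hE V hV
  obtain ⟨L, hL⟩ := hD.exists_agree_subset (O := {p | (ρ p.1, ρ p.2) ∈ W}) (fun x => by
    have h1 : Continuous fun p : D.X 0 × D.X 0 => (ρ p.1, ρ p.2) := by fun_prop
    exact h1.continuousAt.preimage_mem_nhds (nhds_le_uniformity (ρ x) hW))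
  obtain ⟨n, hn⟩ := hD.tendsto_totalLen (2 * L + 1)
  obtain ⟨F, hF⟩ := D.exists_applyIter_eq n
  set P := D.totalLen n with hP
  set z := (hD.nonempty n).some with hz
  set x₀ := D.levelMap n z with hx₀
  -- `S` consists of the `s` for which `P s` is a `V`-almost period along the whole orbit of `x₀`.
  let S : Set ℤ := {s | ∀ k : ℤ, (ρ ((T ^ k) x₀), ρ ((T ^ (k + P * s)) x₀)) ∈ V}
  have hneg : ∀ s ∈ S, -s ∈ S := fun s hs k => by
    have := hs (k + P * -s)
    rw [add_assoc, ← mul_add, neg_add_cancel, mul_zero, add_zero] at this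
    exact hVsymm.symm _ _ this
  have hc : ∀ s t, z.1 s = z.1 t → s - t ∈ S := by
    intro s t hst k
    -- As `P ≥ 2 L + 1`, the window of radius `L` around the place `P t + L` lies in the image of
    -- the single letter `z t`.
    have hval : ∀ t i : ℤ, -L ≤ i → i ≤ L →
        ((T ^ (P * t + L)) x₀).1 i = F (z.1 t) (i + L) := by
      intro t i h1 h2
      have hP0 : (P : ℤ) ≠ 0 := by exact_mod_cast (D.totalLen_pos n).ne'
      have hi : i + (P * t + L) = (i + L) + P * t := by ring
      rw [hT, levelShift_zpow_apply, hx₀]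
      simp only [levelMap]
      rw [hF, hi, Int.add_mul_ediv_left _ _ hP0, Int.add_mul_emod_self_left,
        Int.ediv_eq_zero_of_lt (by omega) (by omega), Int.emod_eq_of_lt (by omega) (by omega),
        zero_add]
    have h1 := hL ((T ^ (P * t + L : ℤ)) x₀) ((T ^ (P * s + L : ℤ)) x₀) fun i h1 h2 => by
      rw [hval t i h1 h2, hval s i h1 h2, hst]
    have h2 := hWV _ _ h1 (k - P * t - L)
    rw [← Homeomorph.zpow_add_apply', ← Homeomorph.zpow_add_apply'] at h2
    convert h2 using 5 <;> ring_nf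
  have hchain : ∀ j, ∀ s ∈ iteratedSum S j, ∀ k : ℤ,
      (ρ ((T ^ k) x₀), ρ ((T ^ (k + P * s)) x₀)) ∈ (fun W => SetRel.comp V W)^[j] V := by
    intro j
    induction j with
    | zero =>
      rintro s rfl k
      exact mem_uniformity_of_eq hV (by simp)
    | succ j ih =>
      rintro s ⟨b, hb, hsb⟩ k
      rw [Function.iterate_succ_apply']
      refine ⟨_, hsb k, ?_⟩
      have := ih b hb (k + P * (s - b))
      convert this using 4
      ring_nf
  have hfin : ∀ (k : ℤ) (t : ℕ),
      (ρ ((T ^ k) x₀), ρ ((T ^ (k + P * (K.factorial * t))) x₀)) ∈ U := fun k t =>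
    hVU (hchain _ _ (by
      have := D.finite n
      exact factorial_mul_mem_iteratedSum (hK n) z.1 hneg hc t) k)
  -- Quantifying over `k` makes this closed set forward invariant; it contains `x₀`, so it is
  -- everything.
  let Q : Set (D.X 0) := {x | ∀ (k t : ℕ),
    (ρ ((T ^ k) x), ρ ((T ^ (k + K.factorial * P * t)) x)) ∈ U}
  have hQ : Q = Set.univ := by
    refine (hD.isMinimalOn 0).eq_of_subset Q (Set.subset_univ _) ?_ ⟨x₀, fun k t => ?_⟩ ?_
    · simp only [Q, Set.ofPred_forall]
      refine isClosed_iInter fun k => isClosed_iInter fun t => hUcl.preimage ?_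
      exact (hρ.comp (T ^ k).continuous).prodMk (hρ.comp (T ^ _).continuous)
    · have := hfin k t
      rw [zpow_natCast] at this
      convert this using 3
      rw [← zpow_natCast]
      congr 2
      push_cast
      ring
    · intro x hx k t
      have := hx (k + 1) t
      rw [pow_succ, Homeomorph.mul_apply, add_right_comm, pow_succ, Homeomorph.mul_apply] at this
      exact this
  refine ⟨n, fun x t => ?_⟩
  have := hQ.ge (Set.mem_univ x) 0 t
  simpa using this

/-- For the discrete uniformity on `ZMod k`, closeness is equality, so `k ∣ K! p_n`, and `k` is
coprime to `p_n`. -/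
theorem TorsionFree.dvd_factorial_of_hasCyclicFactor (hD : D.TorsionFree) {K : ℕ}
    (hK : ∀ n, Nat.card (D.A n) ≤ K) {k : ℕ} (h : HasCyclicFactor (D.levelShift 0) k)
    (hk : ∀ n, k.Coprime (D.q n)) : k ∣ K.factorial := by
  obtain ⟨f, hf, hfT⟩ := h
  have hpow : ∀ (n : ℕ) x, f ((D.levelShift 0 ^ n) x) = f x + n := by
    intro n
    induction n with
    | zero => simp
    | succ n ih =>
      intro x
      rw [pow_succ, Homeomorph.mul_apply, ih, hfT]
      push_cast
      ring
  have hzpow : ∀ (n : ℤ) x, f ((D.levelShift 0 ^ n) x) = f x + n := by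
    intro n x
    obtain ⟨m, rfl | rfl⟩ := n.eq_nat_or_neg
    · simpa using hpow m x
    · have := hpow m ((D.levelShift 0 ^ (-(m : ℤ))) x)
      rw [← zpow_natCast, ← Homeomorph.zpow_add_apply', add_neg_cancel, zpow_zero] at this
      push_cast
      rw [show f x = _ from this]
      ring
  let _ : UniformSpace (ZMod k) := ⊥
  have hfc : @Continuous _ _ _ (UniformSpace.toTopologicalSpace) f := by
    convert hf using 1
  have hdiag : ∀ U : Set (ZMod k × ZMod k), U ∈ 𝓤 (ZMod k) ↔ ∀ a, (a, a) ∈ U := fun U =>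
    ⟨fun h a => refl_mem_uniformity h, fun h => by
      change _ ∈ Filter.principal _
      rintro ⟨a, b⟩ hab
      obtain rfl : a = b := hab
      exact h a⟩
  obtain ⟨n, hn⟩ := hD.exists_close_iterates hK (ρ := f) hfc (fun U hU =>
    ⟨{p | p.1 = p.2}, (hdiag _).2 fun _ => rfl, fun x y hxy k => by
      rw [hzpow, hzpow, show f x = f y from hxy]
      exact (hdiag U).1 hU _⟩) (U := {p | p.1 = p.2}) ((hdiag _).2 fun _ => rfl) (by
      have : DiscreteTopology (ZMod k) := inferInstance
      exact isClosed_discrete _)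
  have := hn (hD.nonempty 0).some 1
  simp only [Set.mem_ofPred_eq, hpow, mul_one] at this
  have h0 : ((K.factorial * D.totalLen n : ℕ) : ZMod k) = 0 := by
    simpa using this.symm
  rw [ZMod.natCast_eq_zero_iff] at h0
  refine Nat.Coprime.dvd_of_dvd_mul_right ?_ h0
  exact Nat.Coprime.prod_right fun i _ => hk i

end DirectiveSeq


/-! ### Arithmetic of cyclic factors -/

theorem ZMod.exists_natCast_eq_of_coprime {a b : ℕ} (ha : 0 < a) (hb : 0 < b) (h : a.Coprime b)
    (x : ZMod a) (y : ZMod b) : ∃ m : ℕ, (m : ZMod a) = x ∧ (m : ZMod b) = y := by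
  have : NeZero (a * b) := ⟨(Nat.mul_pos ha hb).ne'⟩
  obtain ⟨m, hm⟩ := ZMod.natCast_zmod_surjective ((ZMod.chineseRemainder h).symm (x, y))
  have := congrArg (ZMod.chineseRemainder h) hm
  rw [RingEquiv.apply_symm_apply, map_natCast] at this
  exact ⟨m, congrArg Prod.fst this, congrArg Prod.snd this⟩

/-- A number splits into a part that divides one of the `p n` and a part coprime to the `q n`. -/
theorem exists_mul_eq_of_primes {P q : ℕ → ℕ} (hmono : ∀ m n, m ≤ n → P m ∣ P n)
    (hP : ∀ p, p.Prime → ∀ k, p ∣ q k → ∀ e, ∃ n, p ^ e ∣ P n) {d : ℕ} (hd : d ≠ 0) :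
    ∃ a b, d = a * b ∧ (∃ n, a ∣ P n) ∧ ∀ n, b.Coprime (q n) := by
  induction d using Nat.recOnPosPrimePosCoprime with
  | prime_pow p n hp hpos =>
    by_cases h : ∃ k, p ∣ q k
    · obtain ⟨k, hk⟩ := h
      exact ⟨p ^ n, 1, (mul_one _).symm, hP p hp k hk n, fun _ => Nat.coprime_one_left _⟩
    · push Not at h
      exact ⟨1, p ^ n, (one_mul _).symm, ⟨0, one_dvd _⟩,
        fun k => Nat.Coprime.pow_left _ ((Nat.Prime.coprime_iff_not_dvd hp).2 (h k))⟩
  | zero => exact absurd rfl hd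
  | one => exact ⟨1, 1, rfl, ⟨0, one_dvd _⟩, fun _ => Nat.coprime_one_left _⟩
  | coprime a b ha hb hab iha ihb =>
    obtain ⟨a₁, a₂, rfl, ⟨n, hn⟩, h₂⟩ := iha (by omega)
    obtain ⟨b₁, b₂, rfl, ⟨m, hm⟩, h₂'⟩ := ihb (by omega)
    refine ⟨a₁ * b₁, a₂ * b₂, mul_mul_mul_comm _ _ _ _, ⟨max n m, ?_⟩,
      fun n => Nat.Coprime.mul_left (h₂ n) (h₂' n)⟩
    exact Nat.Coprime.mul_dvd_of_dvd_of_dvd (hab.coprime_mul_right.coprime_mul_right_right)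
      (hn.trans (hmono _ _ (le_max_left _ _))) (hm.trans (hmono _ _ (le_max_right _ _)))

/-- The difference of `f` and the reduction of `g` is invariant, hence constant. -/
theorem IsMinimalOn.apply_eq_of_dvd {X : Type u} [TopologicalSpace X] {T : X ≃ₜ X}
    (hT : IsMinimalOn T Set.univ) {k l : ℕ} (hkl : k ∣ l) {f : X → ZMod k} {g : X → ZMod l}
    (hf : Continuous f) (hg : Continuous g) (hfT : ∀ x, f (T x) = f x + 1)
    (hgT : ∀ x, g (T x) = g x + 1) {x y : X} (h : g x = g y) : f x = f y := by
  have := hT.apply_eq_of_invariant (g := fun x => f x - ZMod.castHom hkl (ZMod k) (g x))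
    (hf.sub (continuous_of_discreteTopology.comp hg)) (fun x => by
      simp only [hfT, hgT, map_add, map_one]
      ring) x y
  simp only [h] at this
  exact sub_left_injective this

/-! ### The odometer -/

section OdometerTopology

theorem odometer_isClosed (q : ℕ → ℕ) :
    IsClosed (odometer q : Set (∀ n, ZMod (∏ i ∈ Finset.range n, q i))) := by
  have : (odometer q : Set (∀ n, ZMod (∏ i ∈ Finset.range n, q i))) =
      ⋂ n, {z | ZMod.castHom (Dvd.intro (q n) (Finset.prod_range_succ q n).symm)
        (ZMod (∏ i ∈ Finset.range n, q i)) (z (n + 1)) = z n} := by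
    ext z
    simp only [Set.mem_iInter]
    rfl
  rw [this]
  exact isClosed_iInter fun n => isClosed_eq
    (continuous_of_discreteTopology.comp (continuous_apply (n + 1))) (continuous_apply n)

theorem odometer_compactSpace {q : ℕ → ℕ} (hq : ∀ n, 0 < q n) : CompactSpace (odometer q) := by
  have : ∀ n, NeZero (∏ i ∈ Finset.range n, q i) :=
    fun n => ⟨(Finset.prod_pos fun i _ => hq i).ne'⟩
  exact isCompact_iff_compactSpace.1 (odometer_isClosed q).isCompact

theorem odometerRotation_zpow_apply (q : ℕ → ℕ) (h : ℕ) (k : ℤ) (z : odometer q × ZMod h) :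
    (odometerRotation q h ^ k) z = z + k • (odometerOne q, (1 : ZMod h)) := by
  have h1 : ∀ z, odometerRotation q h z = z + (odometerOne q, (1 : ZMod h)) := fun _ => rfl
  have h2 : ∀ z, (odometerRotation q h)⁻¹ z = z + -(odometerOne q, (1 : ZMod h)) :=
    fun _ => rfl
  induction k generalizing z with
  | zero => simp
  | succ k ih => rw [zpow_add, Homeomorph.mul_apply, zpow_one, ih, h1, add_zsmul, one_zsmul]; abel
  | pred k ih => rw [zpow_sub, Homeomorph.mul_apply, zpow_one, ih, h2, sub_zsmul, one_zsmul]; abel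

theorem isEquicontinuousSystem_odometerRotation {q : ℕ → ℕ} (hq : ∀ n, 0 < q n) {h : ℕ}
    (hh : 0 < h) : IsEquicontinuousSystem (odometerRotation q h) := by
  have := odometer_compactSpace hq
  have : NeZero h := ⟨hh.ne'⟩
  refine ⟨inferInstance, inferInstance,
    IsTopologicalAddGroup.rightUniformSpace (odometer q × ZMod h), rfl, ?_⟩
  let _ := IsTopologicalAddGroup.rightUniformSpace (odometer q × ZMod h)
  intro z U hU
  obtain ⟨N, hN, hNU⟩ := Filter.mem_comap.1 hU
  have hcont : Continuous fun w : odometer q × ZMod h => w - z := continuous_id.sub continuous_const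
  have : ∀ᶠ w in nhds z, w - z ∈ N :=
    hcont.continuousAt.eventually_mem (by simpa using hN)
  filter_upwards [this] with w hw k
  refine hNU ?_
  simp only [Set.mem_preimage, odometerRotation_zpow_apply]
  convert hw using 1
  abel

end OdometerTopology

/-! ### The maximal equicontinuous factor and the height -/

namespace DirectiveSeq

variable {D : DirectiveSeq.{u}}

theorem levelShift_zero_apply (x : D.X 0) : D.levelShift 0 x = D.shift x := rfl

theorem coprime_totalLen {k : ℕ} (h : ∀ n, k.Coprime (D.q n)) (n : ℕ) :
    k.Coprime (D.totalLen n) := Nat.Coprime.prod_right fun i _ => h i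

/-- The orders in question are bounded by `K!` and closed under `lcm`, so the largest is a multiple
of all others. -/
theorem TorsionFree.exists_max_cyclicFactor (hD : D.TorsionFree) (hb : D.BoundedAlphabets) :
    ∃ h, 0 < h ∧ (∀ n, h.Coprime (D.q n)) ∧ HasCyclicFactor (D.levelShift 0) h ∧
      ∀ k, 0 < k → (∀ n, k.Coprime (D.q n)) → HasCyclicFactor (D.levelShift 0) k → k ∣ h := by
  classical
  obtain ⟨K, hK⟩ := hb
  let p : ℕ → Prop := fun k => 0 < k ∧ (∀ n, k.Coprime (D.q n)) ∧
    HasCyclicFactor (D.levelShift 0) k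
  have hp1 : p 1 := ⟨one_pos, fun _ => Nat.coprime_one_left _, HasCyclicFactor.one⟩
  have hle : ∀ k, p k → k ≤ K.factorial := fun k hk =>
    Nat.le_of_dvd (Nat.factorial_pos K) (hD.dvd_factorial_of_hasCyclicFactor hK hk.2.2 hk.2.1)
  have hp := Nat.findGreatest_spec (hle 1 hp1) hp1
  refine ⟨_, hp.1, hp.2.1, hp.2.2, fun k h0 hc hk => ?_⟩
  set h := Nat.findGreatest p K.factorial
  have hl : p (h.lcm k) := ⟨Nat.lcm_pos hp.1 h0,
    fun n => Nat.Coprime.coprime_dvd_left (Nat.lcm_dvd_mul h k)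
      (Nat.Coprime.mul_left (hp.2.1 n) (hc n)),
    hp.2.2.lcm hp.1.ne' h0.ne' hk⟩
  have h1 : h.lcm k ≤ h := Nat.le_findGreatest (hle _ hl) hl
  have h2 := Nat.le_antisymm h1 (Nat.le_of_dvd hl.1 (Nat.dvd_lcm_left h k))
  exact h2 ▸ Nat.dvd_lcm_right h k

/-- The factor map onto the odometer times a cyclic group. -/
theorem TorsionFree.exists_isFactorMap (hD : D.TorsionFree) (hb : D.BoundedAlphabets) {h : ℕ}
    (hh : 0 < h) (hc : ∀ n, h.Coprime (D.q n)) (hf : HasCyclicFactor (D.levelShift 0) h) :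
    ∃ π : D.X 0 → odometer D.q × ZMod h, IsFactorMap D.shift (odometerRotation D.q h) π := by
  have := hD.compactSpace 0
  set x₀ := (hD.nonempty 0).some
  have hcyc : ∀ n, HasCyclicFactor (D.levelShift 0) (∏ i ∈ Finset.range n, D.q i) :=
    hD.hasCyclicFactor_totalLen hb
  choose f hfc hfT using hcyc
  obtain ⟨g, hg, hgT⟩ := hf
  -- Normalising all levels to vanish at `x₀` makes them compatible.
  let F : ∀ n, D.X 0 → ZMod (∏ i ∈ Finset.range n, D.q i) := fun n x => f n x - f n x₀
  have hFc : ∀ n, Continuous (F n) := fun n => (hfc n).sub continuous_const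
  have hFT : ∀ n x, F n (D.levelShift 0 x) = F n x + 1 := fun n x => by
    simp only [F, hfT]
    ring
  have hF : ∀ x, (fun n => F n x) ∈ odometer D.q := by
    intro x n
    have := (hD.isMinimalOn 0).apply_eq_of_invariant (g := fun x => F n x -
      ZMod.castHom (Dvd.intro (D.q n) (Finset.prod_range_succ D.q n).symm)
        (ZMod (∏ i ∈ Finset.range n, D.q i)) (F (n + 1) x))
      ((hFc n).sub (continuous_of_discreteTopology.comp (hFc (n + 1)))) (fun x => by
        simp only [hFT, map_add, map_one]
        ring) x x₀
    have h0 : ∀ n, F n x₀ = 0 := fun n => sub_self _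
    simp only [h0, map_zero, sub_self] at this
    exact (sub_eq_zero.1 this).symm
  have hpow : ∀ n m : ℕ, F n ((D.levelShift 0 ^ m) x₀) = m ∧
      g ((D.levelShift 0 ^ m) x₀) = g x₀ + m := by
    intro n m
    induction m with
    | zero => simp [F]
    | succ m ih =>
      rw [pow_succ', Homeomorph.mul_apply, hFT, hgT, ih.1, ih.2]
      push_cast
      exact ⟨rfl, add_assoc _ _ _⟩
  refine ⟨fun x => (⟨fun n => F n x, hF x⟩, g x), ?_, ?_, ?_⟩
  · have hFc' : Continuous fun x : D.X 0 => (⟨fun n => F n x, hF x⟩ : odometer D.q) :=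
      Continuous.subtype_mk (continuous_pi hFc) hF
    exact hFc'.prodMk hg
  · rintro ⟨z, t⟩
    let C : ℕ → Set (D.X 0) := fun n => F n ⁻¹' {z.1 n} ∩ g ⁻¹' {t}
    have hcl : ∀ n, IsClosed (C n) := fun n =>
      ((isClosed_discrete _).preimage (hFc n)).inter ((isClosed_discrete _).preimage hg)
    have hanti : Antitone C := antitone_nat_of_succ_le fun n x hx => by
      refine ⟨?_, hx.2⟩
      exact ((hF x n).symm.trans (congrArg _ hx.1)).trans (z.2 n)
    obtain ⟨x, hx⟩ := IsCompact.nonempty_iInter_of_directed_nonempty_isCompact_isClosed C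
      (directed_of_isDirected_le hanti) (fun n => by
        obtain ⟨m, h1, h2⟩ := ZMod.exists_natCast_eq_of_coprime (D.totalLen_pos n) hh
          (coprime_totalLen hc n).symm (z.1 n) (t - g x₀)
        refine ⟨(D.levelShift 0 ^ m) x₀, (hpow n m).1.trans h1, ?_⟩
        rw [Set.mem_preimage, (hpow n m).2, h2, add_sub_cancel]
        rfl) (fun n => (hcl n).isCompact) hcl
    rw [Set.mem_iInter] at hx
    exact ⟨x, Prod.ext (Subtype.ext (funext fun n => (hx n).1)) (hx 0).2⟩
  · intro x
    exact Prod.ext (Subtype.ext (funext fun n => hFT n x)) (hgT x)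

theorem IsFactorMap.continuous_level {h : ℕ} {π : D.X 0 → odometer D.q × ZMod h}
    (hπ : IsFactorMap D.shift (odometerRotation D.q h) π) (n : ℕ) :
    Continuous (fun x => ((π x).1.1 n : ZMod (D.totalLen n))) :=
  (continuous_apply n).comp (continuous_subtype_val.comp (continuous_fst.comp hπ.continuous))

theorem IsFactorMap.level_shift {h : ℕ} {π : D.X 0 → odometer D.q × ZMod h}
    (hπ : IsFactorMap D.shift (odometerRotation D.q h) π) (n : ℕ) (x : D.X 0) :
    ((π (D.levelShift 0 x)).1.1 n : ZMod (D.totalLen n)) = (π x).1.1 n + 1 := by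
  rw [levelShift_zero_apply, hπ.semiconj x]
  rfl

theorem IsFactorMap.snd_shift {h : ℕ} {π : D.X 0 → odometer D.q × ZMod h}
    (hπ : IsFactorMap D.shift (odometerRotation D.q h) π) (x : D.X 0) :
    (π (D.levelShift 0 x)).2 = (π x).2 + 1 := by
  rw [levelShift_zero_apply, hπ.semiconj x]
  rfl

/-- If `π x = π y`, then `x` and `y` agree in the cyclic factor whose fibres are orbit closures of
`T ^ (K! p_n)`. So `y` is a limit of iterates of `x` that `ρ` hardly moves, whence `ρ x = ρ y`. -/
theorem TorsionFree.isMEFMap (hD : D.TorsionFree) (hb : D.BoundedAlphabets) {h : ℕ}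
    (hh : 0 < h) (hmax : ∀ k, 0 < k → (∀ n, k.Coprime (D.q n)) →
      HasCyclicFactor (D.levelShift 0) k → k ∣ h) {π : D.X 0 → odometer D.q × ZMod h}
    (hπ : IsFactorMap D.shift (odometerRotation D.q h) π) :
    IsMEFMap D.shift (odometerRotation D.q h) π := by
  have := hD.compactSpace 0
  refine ⟨hπ, isEquicontinuousSystem_odometerRotation D.q_pos hh, ?_⟩
  rintro Y τ R ρ ⟨hYc, hYh, 𝒰, rfl, hequi⟩ hρ
  obtain ⟨K, hK⟩ := hb
  have hρz : ∀ (k : ℤ) x, ρ ((D.levelShift 0 ^ k) x) = (R ^ k) (ρ x) := by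
    have h1 : ∀ x, ρ (D.levelShift 0 x) = R (ρ x) := hρ.semiconj
    have h2 : ∀ x, ρ ((D.levelShift 0)⁻¹ x) = R⁻¹ (ρ x) := fun x => by
      have : R (ρ ((D.levelShift 0)⁻¹ x)) = ρ x := by
        rw [← h1, ← Homeomorph.mul_apply, mul_inv_cancel]
        rfl
      rw [← this, ← Homeomorph.mul_apply R⁻¹ R, inv_mul_cancel]
      rfl
    intro k
    induction k with
    | zero => simp
    | succ k ih =>
      intro x
      rw [zpow_add, zpow_add, Homeomorph.mul_apply, ih, zpow_one, h1]
      rfl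
    | pred k ih =>
      intro x
      rw [zpow_sub, zpow_sub, Homeomorph.mul_apply, ih, zpow_one, h2]
      rfl
  have hkey : ∀ x y, π x = π y → ρ x = ρ y := by
    intro x y hxy
    refine eq_of_uniformity fun {U} hU => ?_
    obtain ⟨U', hU', hcl, hsub⟩ := mem_uniformity_isClosed hU
    have huc := CompactSpace.uniformEquicontinuous_of_equicontinuous hequi
    obtain ⟨n, hn⟩ := hD.exists_close_iterates hK hρ.continuous (fun U hU =>
      ⟨_, huc U hU, fun x y hxy k => by
        rw [hρz, hρz]
        exact hxy k⟩) hU' hcl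
    obtain ⟨d, hd, -, f, hf, hfT, hcls⟩ := (hD.isMinimalOn 0).exists_cyclicFactor_closure
      (Nat.mul_pos (Nat.factorial_pos K) (D.totalLen_pos n))
    -- The two parts of the order `d` are seen by the two coordinates of `π`: `a` by the odometer,
    -- `b` by `ZMod h`, by maximality of `h`.
    obtain ⟨a, b, rfl, ⟨m, ham⟩, hbc⟩ := exists_mul_eq_of_primes (P := D.totalLen) (q := D.q)
      (fun _ _ => D.totalLen_dvd) (fun p hp k hk e => hD.exists_pow_dvd_totalLen hp hk e) hd.ne'
    have hfd : HasCyclicFactor (D.levelShift 0) (a * b) := ⟨f, hf, hfT⟩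
    have hbh : b ∣ h := hmax b (Nat.pos_of_mul_pos_left hd) hbc (hfd.of_dvd (dvd_mul_left _ _))
    have hab : a.Coprime b := ((coprime_totalLen hbc m).coprime_dvd_right ham).symm
    have hfa := (hD.isMinimalOn 0).apply_eq_of_dvd ham
      (f := fun x => ZMod.castHom (dvd_mul_right a b) (ZMod a) (f x))
      (continuous_of_discreteTopology.comp hf) (IsFactorMap.continuous_level hπ m)
      (fun x => by rw [hfT, map_add, map_one]) (IsFactorMap.level_shift hπ m) (x := x) (y := y)
      (by rw [hxy])
    have hfb := (hD.isMinimalOn 0).apply_eq_of_dvd hbh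
      (f := fun x => ZMod.castHom (dvd_mul_left b a) (ZMod b) (f x))
      (continuous_of_discreteTopology.comp hf) (continuous_snd.comp hπ.continuous)
      (fun x => by rw [hfT, map_add, map_one]) (IsFactorMap.snd_shift hπ) (x := x) (y := y)
      (by simp only [Function.comp_apply, hxy])
    have hfxy : f x = f y := by
      rw [← sub_eq_zero]
      obtain ⟨m, hm⟩ := ZMod.intCast_surjective (f x - f y)
      rw [← sub_eq_zero, ← map_sub, ← hm, map_intCast, ZMod.intCast_zmod_eq_zero_iff_dvd]
        at hfa hfb
      rw [← hm, ZMod.intCast_zmod_eq_zero_iff_dvd]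
      push_cast
      exact (Nat.isCoprime_iff_coprime.2 hab).mul_dvd hfa hfb
    refine hsub ?_
    have hcl' : IsClosed {z | (ρ x, ρ z) ∈ U'} :=
      hcl.preimage (continuous_const.prodMk hρ.continuous)
    refine closure_minimal ?_ hcl' (hcls x y hfxy)
    rintro _ ⟨t, rfl⟩
    exact hn x t
  have hT2 : T2Space (odometer D.q × ZMod h) := inferInstance
  have hq : Topology.IsQuotientMap π :=
    (hπ.continuous.isClosedMap).isQuotientMap hπ.continuous hπ.surjective
  have hfac : ρ = (fun z => ρ (Function.surjInv hπ.surjective z)) ∘ π := funext fun x =>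
    hkey _ _ (Function.surjInv_eq hπ.surjective (π x)).symm
  refine ⟨fun z => ρ (Function.surjInv hπ.surjective z), ⟨?_, ?_, ?_⟩, hfac⟩
  · rw [hq.continuous_iff, ← hfac]
    exact hρ.continuous
  · intro y
    obtain ⟨x, rfl⟩ := hρ.surjective y
    exact ⟨π x, (congrFun hfac x).symm⟩
  · intro z
    obtain ⟨x, rfl⟩ := hπ.surjective z
    rw [← hπ.semiconj x]
    have h1 := congrFun hfac x
    have h2 := congrFun hfac (D.shift x)
    simp only [Function.comp_apply] at h1 h2 ⊢
    rw [← h1, ← h2, hρ.semiconj x]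

/-- `ZMod k` is a factor of the odometer times `ZMod h`. There the rotation by `p_n h` tends to the
identity, so `k ∣ p_n h` for some `n`, and `k` is coprime to `p_n`. -/
theorem IsHeight.dvd (hD : D.TorsionFree) {h k : ℕ} (hh : D.IsHeight h) (hk : D.IsHeight k) :
    k ∣ h := by
  have := hD.compactSpace 0
  obtain ⟨hh0, hhc, π, hπ⟩ := hh
  obtain ⟨hk0, hkc, π', hπ'⟩ := hk
  have : NeZero k := ⟨hk0.ne'⟩
  -- The lift places `ZMod k` in the universe over which maximality quantifies.
  let R : ULift.{u} (ZMod k) ≃ₜ ULift.{u} (ZMod k) :=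
    Homeomorph.ulift.trans ((Homeomorph.addRight (1 : ZMod k)).trans Homeomorph.ulift.symm)
  have : DiscreteTopology (ULift.{u} (ZMod k)) := inferInstance
  have hR : IsEquicontinuousSystem R := by
    refine ⟨inferInstance, inferInstance, ⊥, this.eq_bot.symm, ?_⟩
    intro x U hU
    have : ∀ᶠ y in nhds x, y = x := by
      rw [nhds_discrete]
      exact Filter.eventually_pure.2 rfl
    filter_upwards [this] with y hy n
    rw [hy]
    exact @refl_mem_uniformity _ ⊥ _ _ hU
  obtain ⟨φ, hφ, -⟩ := hπ.maximal _ R (fun x => ULift.up (π' x).2) hR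
    ⟨continuous_uliftUp.comp (continuous_snd.comp hπ'.factor.continuous),
      fun y => by
        obtain ⟨x, hx⟩ := hπ'.factor.surjective (0, y.down)
        exact ⟨x, by rw [hx]⟩,
      fun x => congrArg ULift.up (IsFactorMap.snd_shift hπ'.factor x)⟩
  have hφn : ∀ m : ℕ, (φ ((odometerRotation D.q h ^ (m : ℤ)) 0)).down = (φ 0).down + m := by
    intro m
    induction m with
    | zero => simp
    | succ m ih =>
      rw [Nat.cast_succ, add_comm, zpow_add, zpow_one, Homeomorph.mul_apply,
        hφ.semiconj]
      change (φ _).down + 1 = _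
      rw [ih]
      push_cast
      ring
  have htend : Filter.Tendsto
      (fun n => (odometerRotation D.q h ^ ((D.totalLen n * h : ℕ) : ℤ)) 0) Filter.atTop
      (nhds 0) := by
    simp only [odometerRotation_zpow_apply, zero_add]
    refine Filter.Tendsto.prodMk_nhds ?_ ?_
    · rw [tendsto_subtype_rng]
      refine tendsto_pi_nhds.2 fun m => ?_
      refine tendsto_const_nhds.congr' ?_
      filter_upwards [Filter.eventually_ge_atTop m] with n hn
      have h1 : ((D.totalLen n : ℕ) : ZMod (∏ i ∈ Finset.range m, D.q i)) = 0 :=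
        (ZMod.natCast_eq_zero_iff _ _).2 (D.totalLen_dvd hn)
      change (0 : ZMod (∏ i ∈ Finset.range m, D.q i)) = ((D.totalLen n * h : ℕ) : ℤ) • 1
      rw [natCast_zsmul, nsmul_eq_mul, Nat.cast_mul, h1]
      simp
    · refine tendsto_const_nhds.congr fun n => ?_
      change (0 : ZMod h) = ((D.totalLen n * h : ℕ) : ℤ) • 1
      rw [natCast_zsmul, nsmul_eq_mul, Nat.cast_mul, ZMod.natCast_self]
      simp
  have hev := (hφ.continuous.tendsto 0).comp htend
  rw [nhds_discrete, Filter.tendsto_pure] at hev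
  obtain ⟨n, hn⟩ := hev.exists
  have h1 := hφn (D.totalLen n * h)
  rw [show φ _ = φ 0 from hn] at h1
  have h2 : ((D.totalLen n * h : ℕ) : ZMod k) = 0 := by simpa using h1.symm
  rw [ZMod.natCast_eq_zero_iff] at h2
  exact (coprime_totalLen hkc n).dvd_of_dvd_mul_left h2

theorem TorsionFree.existsUnique_isHeight (hD : D.TorsionFree) (hb : D.BoundedAlphabets) :
    ∃! h, D.IsHeight h := by
  obtain ⟨h, hh, hc, hf, hmax⟩ := hD.exists_max_cyclicFactor hb
  obtain ⟨π, hπ⟩ := hD.exists_isFactorMap hb hh hc hf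
  have hheight : D.IsHeight h := ⟨hh, hc, π, hD.isMEFMap hb hh hmax hπ⟩
  exact ⟨h, hheight, fun k hk =>
    Nat.dvd_antisymm (IsHeight.dvd hD hheight hk) (IsHeight.dvd hD hk hheight)⟩

end DirectiveSeq

theorem Set.ncard_range_eq_of_iff {ι α β : Type*} {f : ι → α} {g : ι → β}
    (h : ∀ a b, f a = f b ↔ g a = g b) : (Set.range f).ncard = (Set.range g).ncard := by
  have hker : Setoid.ker f = Setoid.ker g := Setoid.ext h
  rw [← Nat.card_coe_set_eq, ← Nat.card_coe_set_eq,
    ← Nat.card_congr (Setoid.quotientKerEquivRange f), hker,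
    Nat.card_congr (Setoid.quotientKerEquivRange g)]

namespace DirectiveSeq

/-! ### Columns of the pure base -/

theorem injectivisation_comp (B : DirectiveSeq.{u}) (m k : ℕ) (a : B.A (m + k))
    (j : Fin (B.len m k)) :
    B.injectivisation.comp m k (Quotient.mk (B.identification (m + k)) a) j =
      Quotient.mk (B.identification m) (B.comp m k a j) := by
  induction k with
  | zero => rfl
  | succ k ih => exact ih _ _

variable {D : DirectiveSeq.{u}} (U : D.LimitWord) {h : ℕ}

/-- The letter `a` of level `n` of the pure base is the block of `u^(n)` at place `t h`. -/
def IsBlockAt (n : ℕ) (a : (D.pureBase U h).A n) (t : ℕ) : Prop :=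
  ∀ i : Fin h, a.1 i = U.u n ((t * h + i : ℕ) : ℤ)

variable {U}

theorem IsBlockAt.theta {n : ℕ} {a : (D.pureBase U h).A (n + 1)} {t : ℕ}
    (ha : IsBlockAt U (n + 1) a t) (j : Fin (D.q n)) :
    IsBlockAt U n ((D.pureBase U h).θ n a j) (t * D.q n + j) := by
  intro i
  have hq := D.q_pos n
  have hidx : (t * D.q n + j) * h + i = (j * h + i) + D.q n * (t * h) := by ring
  have ha' : ∀ i : Fin h, a.1 i = U.u (n + 1) ((t * h + i : ℕ) : ℤ) := ha
  refine Eq.trans ?_ (congrFun (U.apply_eq n) _)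
  simp only [pureBase, wordImage, apply]
  rw [ha']
  have e1 : (((t * D.q n + j) * h + i : ℕ) : ℤ) / (D.q n : ℤ)
      = ((t * h + (j * h + i) / D.q n : ℕ) : ℤ) := by
    rw [← Int.natCast_ediv, hidx, Nat.add_mul_div_left _ _ hq, Nat.add_comm]
  have e2 : ((((t * D.q n + j) * h + i : ℕ) : ℤ) % (D.q n : ℤ)).toNat
      = (j * h + i) % D.q n := by
    rw [← Int.natCast_emod, hidx, Int.toNat_natCast, Nat.add_mul_mod_self_left]
  congr 2
  · rw [e1]
  · exact e2.symm

theorem IsBlockAt.comp {m k : ℕ} {a : (D.pureBase U h).A (m + k)} {t : ℕ}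
    (ha : IsBlockAt U (m + k) a t) (j : Fin (D.len m k)) :
    IsBlockAt U m ((D.pureBase U h).comp m k a j) (t * D.len m k + j) := by
  induction k generalizing t with
  | zero =>
    have h1 : (j : ℕ) = 0 := by
      have := j.2
      simp only [len, Finset.range_zero, Finset.prod_empty] at this
      omega
    have h2 : D.len m 0 = 1 := rfl
    rw [h1, h2, mul_one, add_zero]
    exact ha
  | succ k ih =>
    have hlt : (j : ℕ) / D.len m k < D.q (m + k) :=
      Nat.div_lt_of_lt_mul (D.len_succ m k ▸ j.isLt)
    have := ih (ha.theta ⟨j / D.len m k, hlt⟩) ⟨j % D.len m k, Nat.mod_lt _ (D.len_pos m k)⟩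
    have e : (t * D.q (m + k) + j / D.len m k) * D.len m k + j % D.len m k =
        t * D.len m (k + 1) + j := by
      have hlen : t * D.len m (k + 1) = t * (D.len m k * D.q (m + k)) :=
        congrArg _ (D.len_succ m k)
      rw [add_mul, add_assoc, Nat.div_add_mod', hlen]
      ring
    rw [← e]
    exact this

/-- Two letters of the pure base are identified if and only if the corresponding words of `u^(0)`
agree. -/
theorem IsBlockAt.identification_iff (hh : 0 < h) {n : ℕ} {a b : (D.pureBase U h).A n} {s t : ℕ}
    (ha : IsBlockAt U n a s) (hb : IsBlockAt U n b t) :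
    ((D.pureBase U h).identification n).r a b ↔ ∀ i < D.totalLen n * h,
      U.u 0 ((s * (D.totalLen n * h) + i : ℕ) : ℤ) =
        U.u 0 ((t * (D.totalLen n * h) + i : ℕ) : ℤ) := by
  induction n generalizing s t with
  | zero =>
    have h1 : D.totalLen 0 = 1 := rfl
    rw [h1, one_mul]
    constructor
    · intro hab i hi
      obtain rfl : a = b := hab
      rw [← ha ⟨i, hi⟩, ← hb ⟨i, hi⟩]
    · intro hab
      exact Subtype.ext (funext fun i => by rw [ha, hb, hab i i.2])
  | succ n ih =>
    have hpos : 0 < D.totalLen n * h := Nat.mul_pos (D.totalLen_pos n) hh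
    have hlen : D.totalLen (n + 1) * h = D.q n * (D.totalLen n * h) := by
      rw [totalLen_succ]
      ring
    have hstep : ((D.pureBase U h).identification (n + 1)).r a b ↔ ∀ j : Fin (D.q n),
        ((D.pureBase U h).identification n).r ((D.pureBase U h).θ n a j)
          ((D.pureBase U h).θ n b j) := Iff.rfl
    rw [hstep, hlen]
    have hidx : ∀ s j i, (s * D.q n + j) * (D.totalLen n * h) + i =
        s * (D.q n * (D.totalLen n * h)) + (j * (D.totalLen n * h) + i) := fun s j i => by ring
    constructor
    · intro hab i hi
      have := (ih (ha.theta ⟨i / (D.totalLen n * h), Nat.div_lt_of_lt_mul (by rwa [mul_comm])⟩)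
        (hb.theta _)).1 (hab _) (i % (D.totalLen n * h)) (Nat.mod_lt _ hpos)
      simp only [hidx, Nat.div_add_mod'] at this
      exact this
    · intro hab j
      refine (ih (ha.theta j) (hb.theta j)).2 fun i hi => ?_
      simp only [hidx]
      exact hab _ (by
        have h1 : (j + 1 : ℕ) * (D.totalLen n * h) ≤ D.q n * (D.totalLen n * h) :=
          Nat.mul_le_mul_right _ j.2
        rw [add_mul, one_mul] at h1
        omega)

variable (U h) in
/-- The words of length `h p_m` of `u^(0)` at the places `s h p_m`, `s ≡ j`, where the congruence is
modulo the length of `θ^[m, m+k)`. -/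
def columnWords (m k j : ℕ) : Set (Fin (D.totalLen m * h) → D.A 0) :=
  Set.range fun (t : ℕ) i => U.u 0 (((t * D.len m k + j) * (D.totalLen m * h) + i : ℕ) : ℤ)

/-- All letters of the pure base are blocks of `u^(m+k)`, so a column runs over their places `t`;
identified letters are equal words of `u^(0)`. -/
theorem columnMin_injectivisation_pureBase (hh : 0 < h) (m : ℕ) :
    (D.pureBase U h).injectivisation.columnMin m =
      sInf {c | ∃ k, 0 < k ∧ ∃ j : Fin (D.len m k), c = (columnWords U h m k j).ncard} := by
  unfold columnMin
  have hcard : ∀ k (j : Fin (D.len m k)),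
      (Set.range fun a => (D.pureBase U h).injectivisation.comp m k a j).ncard =
        (columnWords U h m k j).ncard := by
    intro k j
    let blk : ℕ → (D.pureBase U h).A (m + k) := fun t =>
      ⟨fun i => U.u (m + k) ((t * h + i : ℕ) : ℤ), t, fun _ => rfl⟩
    have hblk : ∀ t, IsBlockAt U (m + k) (blk t) t := fun t i => rfl
    have h1 : (Set.range fun a => (D.pureBase U h).injectivisation.comp m k a j) =
        Set.range fun t : ℕ => Quotient.mk ((D.pureBase U h).identification m)
          ((D.pureBase U h).comp m k (blk t) j) := by
      ext w
      constructor
      · rintro ⟨a, rfl⟩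
        induction a using Quotient.inductionOn with
        | h a =>
          obtain ⟨t, ht⟩ := a.2
          refine ⟨t, ?_⟩
          have : blk t = a := Subtype.ext (funext fun i => (ht i).symm)
          simp only [this]
          exact (injectivisation_comp _ m k a j).symm
      · rintro ⟨t, rfl⟩
        exact ⟨Quotient.mk _ (blk t), injectivisation_comp _ m k (blk t) j⟩
    rw [h1]
    refine Set.ncard_range_eq_of_iff fun s t => ?_
    refine (Quotient.eq (r := (D.pureBase U h).identification m)).trans ?_
    refine (((hblk s).comp j).identification_iff hh ((hblk t).comp j)).trans ?_
    exact ⟨fun h => funext fun i => h i i.2, fun h i hi => congrFun h ⟨i, hi⟩⟩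
  congr 1
  ext c
  refine exists_congr fun k => and_congr_right fun _ => ?_
  constructor
  · rintro ⟨j, rfl⟩
    exact ⟨j, hcard k j⟩
  · rintro ⟨j, rfl⟩
    exact ⟨j, (hcard k j).symm⟩

theorem columnMin_le_card (B : DirectiveSeq.{u}) (m : ℕ) :
    B.injectivisation.columnMin m ≤ Nat.card (B.A (m + 1)) := by
  have := B.injectivisation.finite (m + 1)
  have := B.finite (m + 1)
  have hmem : B.injectivisation.columnMin m ≤
      (Set.range fun a => B.injectivisation.comp m 1 a ⟨0, B.len_pos m 1⟩).ncard :=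
    Nat.sInf_le ⟨1, one_pos, ⟨0, B.len_pos m 1⟩, rfl⟩
  refine hmem.trans ?_
  rw [← Set.image_univ]
  refine (Set.ncard_image_le Set.finite_univ).trans ?_
  rw [Set.ncard_univ]
  exact Nat.card_le_card_of_surjective _ (Quotient.mk_surjective (s := B.identification (m + 1)))

/-- Without this bound the supremum defining the column number would take the default value `0`. -/
theorem bddAbove_columnMin (hb : D.BoundedAlphabets) :
    BddAbove (Set.range (D.pureBase U h).injectivisation.columnMin) := by
  obtain ⟨K, hK⟩ := hb
  refine ⟨K ^ h, ?_⟩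
  rintro _ ⟨m, rfl⟩
  refine (columnMin_le_card _ m).trans ?_
  have := D.finite (m + 1)
  refine (Nat.card_le_card_of_injective _
    (Subtype.val_injective (p := (· ∈ blocks h (U.u (m + 1)))))).trans ?_
  rw [Nat.card_fun, Nat.card_fin]
  exact Nat.pow_le_pow_left (hK _) _

end DirectiveSeq

/-! ### Fibres of the factor map and column words -/

namespace DirectiveSeq

variable {D : DirectiveSeq.{u}} {h : ℕ} {π : D.X 0 → odometer D.q × ZMod h}

/-- The set of the points whose image under `π` agrees with `z` up to level `n`. -/
def levelClass (π : D.X 0 → odometer D.q × ZMod h) (z : odometer D.q × ZMod h) (n : ℕ) :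
    Set (D.X 0) :=
  {x | (π x).1.1 n = z.1.1 n ∧ (π x).2 = z.2}

theorem isClopen_levelClass (hπ : IsFactorMap D.shift (odometerRotation D.q h) π)
    (z : odometer D.q × ZMod h) (n : ℕ) : IsClopen (levelClass π z n) :=
  ((isClopen_discrete {z.1.1 n}).preimage (IsFactorMap.continuous_level hπ n)).inter
    ((isClopen_discrete {z.2}).preimage (continuous_snd.comp hπ.continuous))

theorem levelClass_antitone (z : odometer D.q × ZMod h) : Antitone (levelClass π z) :=
  antitone_nat_of_succ_le fun n x hx =>
    ⟨((π x).1.2 n).symm.trans ((congrArg _ hx.1).trans (z.1.2 n)), hx.2⟩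

theorem iInter_levelClass (z : odometer D.q × ZMod h) : ⋂ n, levelClass π z n = π ⁻¹' {z} := by
  ext x
  simp only [Set.mem_iInter, Set.mem_preimage, Set.mem_singleton_iff]
  constructor
  · exact fun hx => Prod.ext (Subtype.ext (funext fun n => (hx n).1)) (hx 0).2
  · rintro rfl n
    exact ⟨rfl, rfl⟩

theorem levelClass_eq_of_mem {z w : odometer D.q × ZMod h} {n : ℕ} {x : D.X 0}
    (hz : x ∈ levelClass π z n) (hw : x ∈ levelClass π w n) :
    levelClass π z n = levelClass π w n := by
  unfold levelClass
  rw [← hz.1, ← hz.2, ← hw.1, ← hw.2]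

theorem IsFactorMap.pow_apply (hπ : IsFactorMap D.shift (odometerRotation D.q h) π) (n t : ℕ)
    (x : D.X 0) :
    ((π ((D.levelShift 0 ^ t) x)).1.1 n : ZMod (∏ i ∈ Finset.range n, D.q i)) =
        (π x).1.1 n + t ∧
      (π ((D.levelShift 0 ^ t) x)).2 = (π x).2 + t := by
  induction t with
  | zero => simp
  | succ t ih =>
    rw [pow_succ', Homeomorph.mul_apply, IsFactorMap.snd_shift hπ, ih.2]
    refine ⟨(IsFactorMap.level_shift hπ n _).trans ?_, ?_⟩
    · rw [Nat.cast_succ, ← add_assoc]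
      exact congrArg (· + 1) ih.1
    · push_cast
      ring

/-- The conditions modulo `p_n` and modulo `h` merge into one, these moduli being coprime. -/
theorem pow_mem_levelClass_iff (hπ : IsFactorMap D.shift (odometerRotation D.q h) π)
    (hc : ∀ n, h.Coprime (D.q n)) {z : odometer D.q × ZMod h} {n s t : ℕ} {x : D.X 0}
    (hs : (D.levelShift 0 ^ s) x ∈ levelClass π z n) :
    (D.levelShift 0 ^ t) x ∈ levelClass π z n ↔ t ≡ s [MOD D.totalLen n * h] := by
  have h1 := IsFactorMap.pow_apply hπ n s x
  have h2 := IsFactorMap.pow_apply hπ n t x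
  rw [← Nat.modEq_and_modEq_iff_modEq_mul (coprime_totalLen hc n).symm]
  unfold levelClass
  rw [Set.mem_ofPred_eq, ← hs.1, ← hs.2, h1.1, h1.2, h2.1, h2.2, add_right_inj, add_right_inj,
    ← ZMod.natCast_eq_natCast_iff, ← ZMod.natCast_eq_natCast_iff]
  rfl

theorem exists_pow_mem_levelClass (hπ : IsFactorMap D.shift (odometerRotation D.q h) π)
    (hh : 0 < h) (hc : ∀ n, h.Coprime (D.q n)) (z : odometer D.q × ZMod h) (n : ℕ) (x : D.X 0) :
    ∃ s, s < D.totalLen n * h ∧ (D.levelShift 0 ^ s) x ∈ levelClass π z n := by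
  obtain ⟨m, h1, h2⟩ := ZMod.exists_natCast_eq_of_coprime (D.totalLen_pos n) hh
    (coprime_totalLen hc n).symm (z.1.1 n - (π x).1.1 n) (z.2 - (π x).2)
  have hm : (D.levelShift 0 ^ m) x ∈ levelClass π z n := by
    have h3 := IsFactorMap.pow_apply hπ n m x
    refine ⟨h3.1.trans ?_, h3.2.trans ?_⟩
    · exact (congrArg (fun w => (π x).1.1 n + w) h1).trans (add_sub_cancel _ _)
    · rw [h2, add_sub_cancel]
  refine ⟨m % (D.totalLen n * h), Nat.mod_lt _ (Nat.mul_pos (D.totalLen_pos n) hh), ?_⟩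
  rw [pow_mem_levelClass_iff hπ hc hm]
  exact Nat.mod_modEq _ _

theorem TorsionFree.exists_pow_agree (hD : D.TorsionFree) {O : Set (D.X 0)} (hO : IsOpen O)
    {x : D.X 0} (hx : x ∈ O) (y : D.X 0) (L : ℕ) :
    ∃ t : ℕ, (D.levelShift 0 ^ t) y ∈ O ∧ ∀ i : ℤ, -L ≤ i → i ≤ L → y.1 (i + t) = x.1 i := by
  have hV : IsOpen (⋂ i ∈ Finset.Icc (-L : ℤ) L, {w : D.X 0 | w.1 i ∈ ({x.1 i} : Set _)}) :=
    isOpen_biInter_finset fun i _ =>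
      (BiSeq.isClopen_coord i {x.1 i}).isOpen.preimage continuous_subtype_val
  obtain ⟨t, ht1, ht2⟩ := (hD.isMinimalOn 0).exists_pow_mem (hO.inter hV)
    ⟨x, hx, by simp⟩ y
  refine ⟨t, ht1, fun i h1 h2 => ?_⟩
  simp only [Set.mem_iInter, Finset.mem_Icc] at ht2
  have := ht2 i ⟨h1, h2⟩
  rwa [Set.mem_ofPred_eq, levelShift_pow_apply] at this

/-- The word of length `L` of `x` at place `-s`. -/
def window (s L : ℕ) (x : D.X 0) : Fin L → D.A 0 := fun i => x.1 ((i : ℕ) - (s : ℤ))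

theorem isOpen_preimage_window (s L : ℕ) (W : Set (Fin L → D.A 0)) :
    IsOpen (window s L ⁻¹' W) := by
  have : window s L ⁻¹' W = ⋃ w ∈ W, ⋂ i : Fin L,
      {x : D.X 0 | x.1 ((i : ℕ) - (s : ℤ)) ∈ ({w i} : Set _)} := by
    ext x
    simp only [Set.mem_preimage, Set.mem_iUnion, Set.mem_iInter, Set.mem_ofPred_eq,
      Set.mem_singleton_iff, exists_prop]
    exact ⟨fun hx => ⟨_, hx, fun _ => rfl⟩, fun ⟨w, hw, hxw⟩ => by
      rwa [show window s L x = w from funext hxw]⟩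
  rw [this]
  exact isOpen_biUnion fun w _ => isOpen_iInter_of_finite fun i =>
    (BiSeq.isClopen_coord _ {w i}).isOpen.preimage continuous_subtype_val

theorem totalLen_add (m k : ℕ) : D.totalLen (m + k) = D.totalLen m * D.len m k :=
  Finset.prod_range_add _ _ _

variable (U : D.LimitWord)

theorem finite_columnWords (m k j : ℕ) : (columnWords U h m k j).Finite := by
  have := D.finite 0
  exact Set.toFinite _

/-- The limit word as a point of `X^(0)`. -/
def LimitWord.point : D.X 0 := ⟨U.u 0, U.mem 0⟩

/-- Some column of level `m` consists of words that points of the fibre show in one fixed window. -/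
theorem TorsionFree.columnMin_le_encard (hD : D.TorsionFree)
    (hπ : IsFactorMap D.shift (odometerRotation D.q h) π) (hh : 0 < h)
    (hc : ∀ n, h.Coprime (D.q n)) (z : odometer D.q × ZMod h) (m : ℕ) :
    ((D.pureBase U h).injectivisation.columnMin m : ℕ∞) ≤ (π ⁻¹' {z}).encard := by
  have := hD.compactSpace 0
  obtain ⟨b, hb, hbz⟩ := exists_pow_mem_levelClass hπ hh hc z m U.point
  set P := D.totalLen m * h with hP
  have hP0 : 0 < P := Nat.mul_pos (D.totalLen_pos m) hh
  -- Compactness: a deep enough class around `z` shows no further words in the window.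
  obtain ⟨n, hn⟩ := exists_subset_nhds_of_isCompact' (V := levelClass π z)
    (directed_of_isDirected_le (levelClass_antitone z))
    (fun n => (isClopen_levelClass hπ z n).isClosed.isCompact)
    (fun n => (isClopen_levelClass hπ z n).isClosed)
    (U := window b P ⁻¹' (window b P '' (π ⁻¹' {z}))) (fun x hx => by
      rw [iInter_levelClass] at hx
      exact (isOpen_preimage_window _ _ _).mem_nhds ⟨x, hx, rfl⟩)
  set k := n + 1 with hk
  have hsub : levelClass π z (m + k) ⊆ window b P ⁻¹' (window b P '' (π ⁻¹' {z})) :=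
    (levelClass_antitone z (by omega)).trans hn
  obtain ⟨s, hs, hsz⟩ := exists_pow_mem_levelClass hπ hh hc z (m + k) U.point
  -- Hence the window, which begins `b` places left of the origin, is aligned with the blocks of
  -- length `P` of `u^(0)`.
  have hsb : s % P = b := by
    have := (pow_mem_levelClass_iff hπ hc hbz).1 (levelClass_antitone z (Nat.le_add_right m k) hsz)
    rwa [Nat.ModEq, Nat.mod_eq_of_lt hb] at this
  have hlen : D.totalLen (m + k) * h = P * D.len m k := by
    rw [totalLen_add, hP]
    ring
  have hj : s / P < D.len m k := Nat.div_lt_of_lt_mul (hlen ▸ hs)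
  have hcol : columnWords U h m k (s / P) ⊆ window b P '' (π ⁻¹' {z}) := by
    rintro _ ⟨t, rfl⟩
    have hmem : (D.levelShift 0 ^ (t * (D.totalLen (m + k) * h) + s)) U.point ∈
        levelClass π z (m + k) := by
      rw [pow_mem_levelClass_iff hπ hc hsz]
      simp [Nat.ModEq]
    have := hsub hmem
    rw [Set.mem_preimage] at this
    convert this using 1
    funext i
    simp only [window]
    rw [levelShift_pow_apply]
    simp only [LimitWord.point]
    congr 1
    have h1 : s = s / P * P + b := by rw [← hsb]; exact (Nat.div_add_mod' s P).symm
    rw [hlen]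
    have h2 : ((t * (P * D.len m k) + s : ℕ) : ℤ)
        = t * (P * D.len m k) + ((s / P : ℕ) * P + b) := by
      conv_lhs => rw [h1]
      push_cast
      rfl
    rw [h2]
    change (((t * D.len m k + s / P) * P + i : ℕ) : ℤ) = _
    push_cast
    ring
  have hle : (D.pureBase U h).injectivisation.columnMin m ≤
      (columnWords U h m k (s / P)).ncard := by
    rw [columnMin_injectivisation_pureBase hh]
    exact Nat.sInf_le ⟨k, Nat.succ_pos n, ⟨s / P, hj⟩, rfl⟩
  calc ((D.pureBase U h).injectivisation.columnMin m : ℕ∞)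
      ≤ ((columnWords U h m k (s / P)).ncard : ℕ∞) := by exact_mod_cast hle
    _ = (columnWords U h m k (s / P)).encard := (finite_columnWords U m k _).cast_ncard_eq
    _ ≤ (window b P '' (π ⁻¹' {z})).encard := Set.encard_le_encard hcol
    _ ≤ (π ⁻¹' {z}).encard := Set.encard_image_le _ _

/-- If the points of `F` show at most `c` words in arbitrarily large windows, then `F` has at most
`c` points. -/
theorem encard_le_of_window {F : Set (D.X 0)} {c : ℕ}
    (hF : ∀ L : ℕ, ∃ s N : ℕ, L ≤ s ∧ s + L < N ∧ (window s N '' F).encard ≤ c) :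
    F.encard ≤ c := by
  by_contra! hcon
  -- If the claim fails, some `c + 1` points are told apart by a common window, being finitely many.
  obtain ⟨t, htF, ht⟩ := Set.exists_subset_encard_eq (k := ((c + 1 : ℕ) : ℕ∞)) (s := F)
    (by simpa using Order.add_one_le_of_lt hcon)
  have htfin : t.Finite := Set.finite_of_encard_eq_coe ht
  have hsep : ∀ p : t × t, ∃ L : ℕ,
      (∀ i : ℤ, -L ≤ i → i ≤ L → p.1.1.1 i = p.2.1.1 i) → p.1 = p.2 := by
    rintro ⟨x, y⟩
    by_cases hxy : x = y
    · exact ⟨0, fun _ => hxy⟩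
    · obtain ⟨i, hi⟩ : ∃ i, x.1.1 i ≠ y.1.1 i := by
        by_contra! h
        exact hxy (Subtype.ext (Subtype.ext (funext h)))
      exact ⟨i.natAbs, fun h => absurd (h i (by omega) (by omega)) hi⟩
  choose f hf using hsep
  have := htfin.to_subtype
  obtain ⟨L, hL⟩ := Finite.exists_le f
  obtain ⟨s, N, hs, hN, hle⟩ := hF L
  have hinj : Set.InjOn (window s N) t := by
    intro x hx y hy hxy
    have := hf (⟨x, hx⟩, ⟨y, hy⟩) fun i h1 h2 => by
      have hLp := hL (⟨x, hx⟩, ⟨y, hy⟩)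
      have := congrFun hxy ⟨(i + s).toNat, by omega⟩
      simp only [window] at this
      rwa [show (((i + s).toNat : ℕ) : ℤ) - s = i by omega] at this
    exact congrArg Subtype.val this
  have h1 : (window s N '' t).encard = ((c + 1 : ℕ) : ℕ∞) := by rw [hinj.encard_image, ht]
  have h2 := (Set.encard_le_encard (Set.image_mono htF)).trans hle
  rw [h1] at h2
  have h3 : c + 1 ≤ c := by exact_mod_cast h2
  omega

/-- Refines the residue class of `s` so that the block of level `n` around the origin lies in a
column with at most `c` words, while the new block extends further on both sides. -/
theorem TorsionFree.exists_next_level (hD : D.TorsionFree) (hh : 0 < h) {c : ℕ}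
    (hcol : ∀ m, (D.pureBase U h).injectivisation.columnMin m ≤ c) (n s : ℕ)
    (hs : s < D.totalLen n * h) :
    ∃ n' s' : ℕ, n < n' ∧ s' < D.totalLen n' * h ∧ s' ≡ s [MOD D.totalLen n * h] ∧ s < s' ∧
      D.totalLen n * h - s < D.totalLen n' * h - s' ∧
      (Set.range fun (t : ℕ) (i : Fin (D.totalLen n * h)) =>
        U.u 0 ((t * (D.totalLen n' * h) + (s' - s) + i : ℕ) : ℤ)).encard ≤ c := by
  obtain ⟨k, hk, j, hkj⟩ : ∃ k, 0 < k ∧ ∃ j : Fin (D.len n k),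
      (columnWords U h n k j).ncard ≤ c := by
    have h1 := hcol n
    rw [columnMin_injectivisation_pureBase hh] at h1
    obtain ⟨k, hk, j, hj⟩ := Nat.sInf_mem (s := {c | ∃ k, 0 < k ∧ ∃ j : Fin (D.len n k),
      c = (columnWords U h n k j).ncard}) ⟨_, 1, one_pos, ⟨0, D.len_pos n 1⟩, rfl⟩
    exact ⟨k, hk, j, hj ▸ h1⟩
  set Q := D.totalLen (n + k) with hQ
  have hQ0 : 0 < Q := D.totalLen_pos _
  -- The new origin will lie in the second of at least four blocks of length `Q h`, which leaves
  -- room on both sides.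
  obtain ⟨n', hn'⟩ := hD.tendsto_totalLen (4 * Q)
  have hlt : n + k < n' := by
    by_contra! hcon
    have := D.totalLen_mono hcon
    omega
  obtain ⟨r, hr⟩ := D.totalLen_dvd hlt.le
  rw [← hQ] at hr
  have hr4 : 4 ≤ r := by
    rw [hr, mul_comm] at hn'
    exact Nat.le_of_mul_le_mul_left hn' hQ0
  set P := D.totalLen n * h with hP
  have hQP : Q * h = P * D.len n k := by
    rw [hQ, totalLen_add, hP]
    ring
  have hPQ : P ≤ Q * h := hQP ▸ Nat.le_mul_of_pos_right _ (D.len_pos n k)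
  have hjs : j * P + s < Q * h := by
    have : (j + 1 : ℕ) * P ≤ D.len n k * P := Nat.mul_le_mul_right _ j.2
    rw [hQP, mul_comm P]
    linarith
  have hbig : 4 * (Q * h) ≤ D.totalLen n' * h := by
    rw [hr]
    nlinarith [Nat.mul_le_mul_left (Q * h) hr4]
  have hQh : 0 < Q * h := Nat.mul_pos hQ0 hh
  refine ⟨n', Q * h + (j * P + s), by omega, by omega, ?_, by omega, by omega, ?_⟩
  · rw [hQP, ← add_assoc, mul_comm P, ← add_mul]
    simp [Nat.ModEq]
  · refine (Set.encard_le_encard (t := columnWords U h n k j) ?_).trans ?_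
    · rintro _ ⟨t, rfl⟩
      -- `t r` blocks of length `Q h` make up `t` blocks of level `n'`; the extra `1` is the summand
      -- `Q h` of the new place.
      refine ⟨t * r + 1, funext fun i => ?_⟩
      refine congrArg (fun w : ℕ => U.u 0 (w : ℤ)) ?_
      change ((t * r + 1) * D.len n k + j) * P + i = _
      rw [show Q * h + (j * P + s) - s = Q * h + j * P by omega, hr,
        show t * (Q * r * h) = t * r * (Q * h) by ring, hQP]
      ring
    · rw [← (finite_columnWords U n k j).cast_ncard_eq]
      exact_mod_cast hkj

/-- Iterating the refinement gives nested classes with a common point; its fibre shows at most `c`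
words in windows that exhaust `ℤ`. -/
theorem TorsionFree.exists_encard_le (hD : D.TorsionFree)
    (hπ : IsFactorMap D.shift (odometerRotation D.q h) π) (hh : 0 < h)
    (hc : ∀ n, h.Coprime (D.q n)) {c : ℕ}
    (hcol : ∀ m, (D.pureBase U h).injectivisation.columnMin m ≤ c) :
    ∃ z, (π ⁻¹' {z}).encard ≤ c := by
  have := hD.compactSpace 0
  choose! N S hN hS hSmod hSlt hSlt' hword using hD.exists_next_level U hh hcol
  let st : ℕ → ℕ × ℕ := fun i => Nat.rec (0, 0) (fun _ p => (N p.1 p.2, S p.1 p.2)) i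
  have hst : ∀ i, st (i + 1) = (N (st i).1 (st i).2, S (st i).1 (st i).2) := fun _ => rfl
  have hlt : ∀ i, (st i).2 < D.totalLen (st i).1 * h := by
    intro i
    induction i with
    | zero => exact Nat.mul_pos (D.totalLen_pos 0) hh
    | succ i ih =>
      rw [hst]
      exact hS _ _ ih
  have hgrow : ∀ i, i ≤ (st i).2 ∧ i < D.totalLen (st i).1 * h - (st i).2 := by
    intro i
    induction i with
    | zero => exact ⟨Nat.zero_le _, Nat.sub_pos_of_lt (hlt 0)⟩
    | succ i ih =>
      rw [hst]
      have h1 := hSlt _ _ (hlt i)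
      have h2 := hSlt' _ _ (hlt i)
      exact ⟨by simp only; omega, by simp only; omega⟩
  let V : ℕ → Set (D.X 0) := fun i =>
    levelClass π (π ((D.levelShift 0 ^ (st i).2) U.point)) (st i).1
  have hVself : ∀ i, (D.levelShift 0 ^ (st i).2) U.point ∈ V i := fun i => ⟨rfl, rfl⟩
  have hanti : Antitone V := antitone_nat_of_succ_le fun i => by
    have h1 : (D.levelShift 0 ^ (st (i + 1)).2) U.point ∈ V i :=
      (pow_mem_levelClass_iff hπ hc (hVself i)).2 (hSmod _ _ (hlt i))
    refine (levelClass_antitone _ (hN _ _ (hlt i)).le).trans ?_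
    exact (levelClass_eq_of_mem ⟨rfl, rfl⟩ h1).le
  obtain ⟨x, hx⟩ := IsCompact.nonempty_iInter_of_directed_nonempty_isCompact_isClosed V
    (directed_of_isDirected_le hanti) (fun i => ⟨_, hVself i⟩)
    (fun i => (isClopen_levelClass hπ _ _).isClosed.isCompact)
    fun i => (isClopen_levelClass hπ _ _).isClosed
  rw [Set.mem_iInter] at hx
  refine ⟨π x, encard_le_of_window fun i => ⟨(st i).2, D.totalLen (st i).1 * h, (hgrow i).1,
    by have := (hgrow i).2; omega, ?_⟩⟩
  refine (Set.encard_le_encard ?_).trans (hword _ _ (hlt i))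
  rintro _ ⟨y, hy, rfl⟩
  have hyV : y ∈ V (i + 1) := by
    have := hx (i + 1)
    simp only [V, levelClass, Set.mem_ofPred_eq] at this ⊢
    rwa [show π y = π x from hy]
  -- The word of `y` is read off in `u^(0)` near a time `t` at which the orbit visits the next
  -- class; this fixes `t` modulo the next block length.
  obtain ⟨t, htV, ht⟩ := hD.exists_pow_agree (isClopen_levelClass hπ _ _).isOpen hyV U.point
    (D.totalLen (st i).1 * h)
  have htmod := (pow_mem_levelClass_iff hπ hc (hVself (i + 1))).1 htV
  rw [Nat.ModEq, Nat.mod_eq_of_lt (hlt (i + 1))] at htmod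
  refine ⟨t / (D.totalLen (st (i + 1)).1 * h), funext fun e => ?_⟩
  have he := e.2
  have h1 := hlt i
  simp only [window]
  rw [← ht _ (by omega) (by omega)]
  simp only [LimitWord.point]
  congr 1
  have h2 := Nat.div_add_mod' t (D.totalLen (st (i + 1)).1 * h)
  rw [htmod] at h2
  have h3 := hSlt _ _ (hlt i)
  conv_rhs => rw [← h2]
  rw [hst]
  simp only
  push_cast [Nat.cast_sub h3.le]
  ring

end DirectiveSeq

theorem corollary6p6 (D : DirectiveSeq.{u}) (hD : D.TorsionFree) (hb : D.BoundedAlphabets) :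
    Nonempty D.LimitWord ∧ (∃! h : ℕ, D.IsHeight h) ∧
      ∀ (h : ℕ), D.IsHeight h → ∀ (U : D.LimitWord) (π : D.X 0 → odometer D.q × ZMod h),
        IsMEFMap D.shift (odometerRotation D.q h) π →
          (∃ z, (π ⁻¹' {z}).encard = D.columnNumber U h) ∧
            ∀ k : ℕ, k < D.columnNumber U h → ∀ z, (π ⁻¹' {z}).encard ≠ k := by
  refine ⟨hD.nonempty_limitWord, hD.existsUnique_isHeight hb, ?_⟩
  rintro h ⟨hh, hc, -⟩ U π hπ
  have hbdd := DirectiveSeq.bddAbove_columnMin (U := U) (h := h) hb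
  have hlow : ∀ z, (D.columnNumber U h : ℕ∞) ≤ (π ⁻¹' {z}).encard := by
    intro z
    -- A bounded supremum of natural numbers is attained, so one level gives the full lower bound.
    obtain ⟨m, hm⟩ := Nat.sSup_mem (Set.range_nonempty _) hbdd
    have := hD.columnMin_le_encard U hπ.factor hh hc z m
    rwa [hm] at this
  refine ⟨?_, fun k hk z hz => ?_⟩
  · obtain ⟨z, hz⟩ := hD.exists_encard_le U hπ.factor hh hc (c := D.columnNumber U h)
      (le_ciSup hbdd)
    exact ⟨z, le_antisymm hz (hlow z)⟩
  · have := hlow z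
    rw [hz] at this
    exact absurd (by exact_mod_cast this : D.columnNumber U h ≤ k) (not_le.2 hk)
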